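/- Let $c,T,\varepsilon>0$, let $a_1,b_1,a_2,b_2$ be real bounds and let $y_0\in L^2(0,1)$. For $\Theta=(\theta_1,\theta_2)\in\mathbb R^2$ put $k(\xi;\Theta)=\theta_1\xi+\theta_2\xi^2$ and let $y(x,t;\Theta)$ be the solution of the closed-loop system $$y_t=y_{xx}+cy,\qquad y(0,t)=0,\qquad y(1,t)=\int_0^1k(\xi;\Theta)\,y(\xi,t)\,d\xi,\qquad y(x,0)=y_0(x)\qquad(0<x<1,\ t>0).$$ (A solution is continuous on $[0,1]\times(0,\infty)$, satisfies the equation and the boundary conditions in the classical sense for $t>0$, and attains its initial value in $L^2(0,1)$ as $t\to0^+$.) Consider the equation $$(\theta_1\alpha^2+\theta_2\alpha^2-2\theta_2)\cos\alpha+(\alpha^3-\theta_1\alpha-2\theta_2\alpha)\sin\alpha+2\theta_2=0.\tag{1}$$ Problem P$_2$ is to choose $(\Theta,\alpha)$ so as to minimize $$\frac12\int_0^T\!\!\int_0^1y^2(x,t;\Theta)\,dx\,dt+\frac12\int_0^1k^2(x;\Theta)\,dx$$ subject to $a_1\le\theta_1\le b_1$, $a_2\le\theta_2\le b_2$, $\theta_1^2+\theta_2^2+2\theta_1\theta_2-2\theta_1-4\theta_2\ge0$,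 $c-\alpha^2\le-\varepsilon$ and equation (1). Theorem. Let $(\Theta^*,\alpha^*)$ be an optimal solution of Problem P$_2$ such that $\alpha^*$ is the smallest positive solution of equation (1) with $\Theta=\Theta^*$. Suppose that there is a sequence $(\alpha_n^*)_{n\ge1}$ of positive solutions of equation (1) with $\Theta=\Theta^*$ such that $y_0$ lies in the span of the functions $\sin(\alpha_n^*x)$, that is, $y_0=\sum_{n\ge1}Y_n\sin(\alpha_n^*x)$ for some real $Y_n$, the sum being an unordered sum in $L^2(0,1)$ (finite sums included). Then the closed-loop system corresponding to $\Theta^*$ is stable: it has exactly one solution $y$, and there is a constant $M$ such that $\|y(\cdot,t)\|_{L^2(0,1)}\le M\mathrm e^{-\varepsilon t}$ for all $t>0$. Moreover, for some coefficients $Y_n$ with $y_0=\sum_{n\ge1}Y_n\sin(\alpha_n^*x)$ in $L^2(0,1)$, $$y(x,t)=\sum_{n\ge1}Y_n\,\mathrm e^{(c-(\alpha_n^*)^2)t}\sin(\alpha_n^*x)\qquad(0\le x\le1,\ t>0),$$ and $c-(\alpha_n^*)^2\le-\varepsilon$ for every $n$. -/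

import Mathlib

open MeasureTheory Set Filter Topology

noncomputable section

namespace KernelOpt

/-- Lebesgue measure on the unit interval. -/
def unitMeasure : Measure ℝ := volume.restrict (Icc (0 : ℝ) 1)

/-- The `L²(0,1)` norm of a function, as an extended nonnegative number. -/
def normL2 (f : ℝ → ℝ) : ENNReal := eLpNorm f 2 unitMeasure

/-- The quadratic feedback kernel `k(ξ) = θ₁ ξ + θ₂ ξ²`. -/
def kernel (θ₁ θ₂ : ℝ) (ξ : ℝ) : ℝ := θ₁ * ξ + θ₂ * ξ ^ 2

/-- Solutions `y x t` on `[0,1] × (0,∞)` of the closed-loop system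
`y_t = y_xx + c y`, `y(0,t) = 0`, `y(1,t) = ∫₀¹ k(ξ) y(ξ,t) dξ`, `y(x,0) = y₀(x)`.
The equation and the boundary conditions hold classically for `t > 0`; the initial value is
attained in `L²(0,1)`, so that `y₀` need not be compatible with the boundary conditions. -/
structure IsClosedLoopSolution (c : ℝ) (k y₀ : ℝ → ℝ) (y : ℝ → ℝ → ℝ) : Prop where
  continuousOn : ContinuousOn (fun p : ℝ × ℝ => y p.1 p.2) (Icc 0 1 ×ˢ Ioi 0)
  contDiffOn : ∀ t : ℝ, 0 < t → ContDiffOn ℝ 2 (fun x => y x t) (Ioo 0 1)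
  continuousOn_xx : ContinuousOn
    (fun p : ℝ × ℝ => iteratedDeriv 2 (fun x => y x p.2) p.1) (Ioo 0 1 ×ˢ Ioi 0)
  pde : ∀ x ∈ Ioo (0 : ℝ) 1, ∀ t : ℝ, 0 < t →
    HasDerivAt (fun s => y x s) (iteratedDeriv 2 (fun z => y z t) x + c * y x t) t
  left_boundary : ∀ t : ℝ, 0 < t → y 0 t = 0
  right_boundary : ∀ t : ℝ, 0 < t → y 1 t = ∫ ξ in (0 : ℝ)..1, k ξ * y ξ t
  initial : Tendsto (fun t => normL2 (fun x => y x t - y₀ x)) (𝓝[>] 0) (𝓝 0)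

/-- The cost `½ ∫₀ᵀ ∫₀¹ y² dx dt + ½ ∫₀¹ k² dx` of a kernel `k` with state trajectory `y`. -/
def cost (T : ℝ) (k : ℝ → ℝ) (y : ℝ → ℝ → ℝ) : ℝ :=
  1 / 2 * (∫ t in (0 : ℝ)..T, ∫ x in (0 : ℝ)..1, y x t ^ 2)
    + 1 / 2 * ∫ x in (0 : ℝ)..1, k x ^ 2

/-- The left-hand side of the characteristic equation. -/
def charLHS (θ₁ θ₂ α : ℝ) : ℝ :=
  (θ₁ * α ^ 2 + θ₂ * α ^ 2 - 2 * θ₂) * Real.cos α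
    + (α ^ 3 - θ₁ * α - 2 * θ₂ * α) * Real.sin α + 2 * θ₂

/-- The constraints of Problem P₂: the bounds on `θ₁`, `θ₂` and the three nonlinear
constraints. -/
structure IsFeasible (c ε a₁ b₁ a₂ b₂ θ₁ θ₂ α : ℝ) : Prop where
  mem_bounds₁ : θ₁ ∈ Icc a₁ b₁
  mem_bounds₂ : θ₂ ∈ Icc a₂ b₂
  quadratic : 0 ≤ θ₁ ^ 2 + θ₂ ^ 2 + 2 * θ₁ * θ₂ - 2 * θ₁ - 4 * θ₂
  exponent_le : c - α ^ 2 ≤ -ε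
  root : charLHS θ₁ θ₂ α = 0

/-- `(θ₁, θ₂, α)` is an optimal solution of Problem P₂: it is feasible, and its cost, computed
along the closed-loop solution with its own kernel, is at most the cost of any feasible triple,
computed along the closed-loop solution with that kernel. -/
structure IsOptimal (c T ε a₁ b₁ a₂ b₂ : ℝ) (y₀ : ℝ → ℝ) (θ₁ θ₂ α : ℝ) : Prop where
  feasible : IsFeasible c ε a₁ b₁ a₂ b₂ θ₁ θ₂ α
  cost_le : ∀ y : ℝ → ℝ → ℝ, IsClosedLoopSolution c (kernel θ₁ θ₂) y₀ y →
    ∀ θ₁' θ₂' α' : ℝ, IsFeasible c ε a₁ b₁ a₂ b₂ θ₁' θ₂' α' →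
    ∀ y' : ℝ → ℝ → ℝ, IsClosedLoopSolution c (kernel θ₁' θ₂') y₀ y' →
      cost T (kernel θ₁ θ₂) y ≤ cost T (kernel θ₁' θ₂') y'

/-- `f = ∑ₙ Yₙ sin(αₙ x)`, the (unordered) sum being taken in `L²(0,1)`. -/
def HasSineExpansion (α Y : ℕ → ℝ) (f : ℝ → ℝ) : Prop :=
  Tendsto (fun F : Finset ℕ => normL2 (fun x => f x - ∑ n ∈ F, Y n * Real.sin (α n * x)))
    atTop (𝓝 0)

/-- `f` lies in the span of the functions `sin(αₙ x)`, infinite linear combinations that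
converge in `L²(0,1)` being allowed. -/
def InSineSpan (α : ℕ → ℝ) (f : ℝ → ℝ) : Prop :=
  ∃ Y : ℕ → ℝ, HasSineExpansion α Y f

/-- The closed-loop system with initial state `y₀` is stable with rate `ε`: it has a solution,
any two solutions agree, and the solution tends to zero in `L²(0,1)` at least as fast as a
multiple of `exp(-ε t)`. -/
structure IsStable (c : ℝ) (k y₀ : ℝ → ℝ) (ε : ℝ) : Prop where
  exists_solution : ∃ y : ℝ → ℝ → ℝ, IsClosedLoopSolution c k y₀ y
  unique : ∀ y z : ℝ → ℝ → ℝ, IsClosedLoopSolution c k y₀ y → IsClosedLoopSolution c k y₀ z →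
    ∀ x ∈ Icc (0 : ℝ) 1, ∀ t : ℝ, 0 < t → y x t = z x t
  decay : ∀ y : ℝ → ℝ → ℝ, IsClosedLoopSolution c k y₀ y →
    ∃ M : ℝ, ∀ t : ℝ, 0 < t →
      normL2 (fun x => y x t) ≤ ENNReal.ofReal (M * Real.exp (-ε * t))

end KernelOpt

end

/-! Integrating `k(ξ) sin(βξ)` by parts and multiplying by `β³` shows that equation (1) is exactly
the boundary condition `sin β = ∫₀¹ k(ξ) sin(βξ) dξ`. Every root `β` thus gives the mode
`e^{(c-β²)t} sin(βx)`. Each `α n` is at least the least root `αstar`, so feasibility of `αstar`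
bounds all exponents by `-ε`.

The sines need not be orthogonal, so no Parseval identity is available. Two facts replace it. Large
roots are at least `1/2` apart (`roots_separated`), hence `∑ β⁻²` over the positive roots converges.
With bounded coefficients and distinct frequencies, the series and the derivatives needed then
converge uniformly for `t ≥ δ > 0`. Moreover, in an unconditionally convergent series, multipliers
in `[0,1]` do not increase a bound on the finite partial sums (`norm_sum_smul_le`); this yields both
the `L²` initial value and the decay rate. Equal frequencies are merged beforehand
(`exists_hasSum_injOn_support`).

Uniqueness must avoid `y_x` at the boundary, where no regularity is assumed. For `z = e^{-ct}(y₁ -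
y₂)` let `-w'' = z`, `w(0) = w(1) = 0`. Then `w_t = x z(1,t) - z`, which in time-integrated form
needs only continuity of `z` up to the boundary. The energy `∫ z w = ∫ w'²` satisfies `E' ≤ (κ + κ²)
E` with `κ = ∫ k²` (`energy_inequality`) and tends to `0` as `t → 0⁺`, so it vanishes. -/

noncomputable section

namespace KernelOpt

/-! ### The inverse of the Dirichlet Laplacian on the unit interval -/

/-- The primitive of `f` vanishing at `0`. -/
def primitive (f : ℝ → ℝ) (x : ℝ) : ℝ := ∫ ξ in (0 : ℝ)..x, f ξ

/-- The second primitive `∫₀ˣ (x - ξ) f(ξ) dξ` of `f`. -/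
def secondPrimitive (f : ℝ → ℝ) (x : ℝ) : ℝ :=
  x * primitive f x - primitive (fun ξ => ξ * f ξ) x

/-- The solution `w` of `-w'' = f`, `w(0) = w(1) = 0`. -/
def dirichletSol (f : ℝ → ℝ) (x : ℝ) : ℝ := x * secondPrimitive f 1 - secondPrimitive f x

/-- The derivative of `dirichletSol f`. -/
def dirichletSolDeriv (f : ℝ → ℝ) (x : ℝ) : ℝ := secondPrimitive f 1 - primitive f x

section OneVariable

variable {f h : ℝ → ℝ}

theorem hasDerivAt_primitive (hf : Continuous f) (x : ℝ) : HasDerivAt (primitive f) (f x) x :=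
  intervalIntegral.integral_hasDerivAt_right (hf.intervalIntegrable _ _)
    (hf.stronglyMeasurableAtFilter _ _) hf.continuousAt

theorem continuous_primitive (hf : Continuous f) : Continuous (primitive f) :=
  continuous_iff_continuousAt.2 fun x => (hasDerivAt_primitive hf x).continuousAt

theorem hasDerivAt_secondPrimitive (hf : Continuous f) (x : ℝ) :
    HasDerivAt (secondPrimitive f) (primitive f x) x := by
  have h1 := ((hasDerivAt_id x).mul (hasDerivAt_primitive hf x)).sub
    (hasDerivAt_primitive (f := fun ξ => ξ * f ξ) (by fun_prop) x)
  refine HasDerivAt.congr_deriv (f := secondPrimitive f) h1 ?_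
  simp

theorem hasDerivAt_dirichletSol (hf : Continuous f) (x : ℝ) :
    HasDerivAt (dirichletSol f) (dirichletSolDeriv f x) x := by
  have h1 := ((hasDerivAt_id x).mul_const (secondPrimitive f 1)).sub
    (hasDerivAt_secondPrimitive hf x)
  refine HasDerivAt.congr_deriv (f := dirichletSol f) h1 ?_
  simp [dirichletSolDeriv]

theorem hasDerivAt_dirichletSolDeriv (hf : Continuous f) (x : ℝ) :
    HasDerivAt (dirichletSolDeriv f) (-f x) x :=
  (hasDerivAt_primitive hf x).const_sub _

theorem continuous_dirichletSol (hf : Continuous f) : Continuous (dirichletSol f) :=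
  continuous_iff_continuousAt.2 fun x => (hasDerivAt_dirichletSol hf x).continuousAt

theorem continuous_dirichletSolDeriv (hf : Continuous f) : Continuous (dirichletSolDeriv f) :=
  continuous_iff_continuousAt.2 fun x => (hasDerivAt_dirichletSolDeriv hf x).continuousAt

theorem dirichletSol_zero : dirichletSol f 0 = 0 := by
  simp [dirichletSol, secondPrimitive, primitive]

theorem dirichletSol_one : dirichletSol f 1 = 0 := by
  simp [dirichletSol]

theorem dirichletSol_sub (hf : Continuous f) (hh : Continuous h) (x : ℝ) :
    dirichletSol (fun ξ => f ξ - h ξ) x = dirichletSol f x - dirichletSol h x := by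
  have h1 : ∀ y, primitive (fun ξ => f ξ - h ξ) y = primitive f y - primitive h y := fun y =>
    intervalIntegral.integral_sub (hf.intervalIntegrable _ _) (hh.intervalIntegrable _ _)
  have h2 : ∀ y, primitive (fun ξ => ξ * (f ξ - h ξ)) y
      = primitive (fun ξ => ξ * f ξ) y - primitive (fun ξ => ξ * h ξ) y := fun y => by
    rw [primitive, primitive, primitive, ← intervalIntegral.integral_sub]
    · simp only [mul_sub]
    · exact Continuous.intervalIntegrable (by fun_prop) _ _
    · exact Continuous.intervalIntegrable (by fun_prop) _ _
  simp only [dirichletSol, secondPrimitive, h1, h2]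
  ring

/-- Integration by parts; the Dirichlet values remove the boundary terms. The right side is
symmetric in `f` and `h`, which makes the solution operator self-adjoint. -/
theorem integral_mul_dirichletSol (hf : Continuous f) (hh : Continuous h) :
    ∫ x in (0 : ℝ)..1, f x * dirichletSol h x
      = ∫ x in (0 : ℝ)..1, dirichletSolDeriv f x * dirichletSolDeriv h x := by
  have hqf := continuous_dirichletSolDeriv hf
  have hqh := continuous_dirichletSolDeriv hh
  have hwh := continuous_dirichletSol hh
  have h1 : ∫ x in (0 : ℝ)..1, ((-f x) * dirichletSol h x
      + dirichletSolDeriv f x * dirichletSolDeriv h x) = 0 := by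
    rw [intervalIntegral.integral_eq_sub_of_hasDerivAt (f := fun x =>
      dirichletSolDeriv f x * dirichletSol h x)
      (fun x _ => (hasDerivAt_dirichletSolDeriv hf x).mul (hasDerivAt_dirichletSol hh x))
      (Continuous.intervalIntegrable (by fun_prop) _ _)]
    simp [dirichletSol_zero, dirichletSol_one]
  rw [intervalIntegral.integral_add (Continuous.intervalIntegrable (by fun_prop) _ _)
    (Continuous.intervalIntegrable (by fun_prop) _ _)] at h1
  simp only [neg_mul, intervalIntegral.integral_neg] at h1
  linarith

theorem integral_id_mul (f : ℝ → ℝ) :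
    ∫ x in (0 : ℝ)..1, x * f x = -dirichletSolDeriv f 1 := by
  simp [dirichletSolDeriv, secondPrimitive, primitive]

/-- The square of the trace of `w'` at `1`. -/
theorem sq_dirichletSolDeriv_one (hf : Continuous f) :
    dirichletSolDeriv f 1 ^ 2 = (∫ x in (0 : ℝ)..1, dirichletSolDeriv f x ^ 2)
      - 2 * ∫ x in (0 : ℝ)..1, x * dirichletSolDeriv f x * f x := by
  have hqf := continuous_dirichletSolDeriv hf
  have h1 : ∫ x in (0 : ℝ)..1, (dirichletSolDeriv f x ^ 2
      - 2 * (x * dirichletSolDeriv f x * f x)) = dirichletSolDeriv f 1 ^ 2 := by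
    rw [intervalIntegral.integral_eq_sub_of_hasDerivAt (f := fun x =>
      x * dirichletSolDeriv f x ^ 2) _ (Continuous.intervalIntegrable (by fun_prop) _ _)]
    · simp
    · intro x _
      refine HasDerivAt.congr_deriv (f := fun x => x * dirichletSolDeriv f x ^ 2)
        ((hasDerivAt_id x).mul ((hasDerivAt_dirichletSolDeriv hf x).pow 2)) ?_
      simp
      ring
  rw [intervalIntegral.integral_sub (Continuous.intervalIntegrable (by fun_prop) _ _)
    (Continuous.intervalIntegrable (by fun_prop) _ _),
    intervalIntegral.integral_const_mul] at h1
  exact h1.symm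

/-- The inequality behind the energy estimate: the boundary feedback term is absorbed. -/
theorem energy_inequality {k : ℝ → ℝ} (hk : Continuous k) (hf : Continuous f) :
    ∫ x in (0 : ℝ)..1, 2 * f x * (x * (∫ ξ in (0 : ℝ)..1, k ξ * f ξ) - f x)
      ≤ ((∫ x in (0 : ℝ)..1, k x ^ 2) + (∫ x in (0 : ℝ)..1, k x ^ 2) ^ 2)
        * ∫ x in (0 : ℝ)..1, dirichletSolDeriv f x ^ 2 := by
  have hq := continuous_dirichletSolDeriv hf
  set q := dirichletSolDeriv f
  obtain ⟨κ, hκ⟩ : ∃ κ, κ = ∫ x in (0 : ℝ)..1, k x ^ 2 := ⟨_, rfl⟩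
  obtain ⟨g, hg⟩ : ∃ g, g = ∫ ξ in (0 : ℝ)..1, k ξ * f ξ := ⟨_, rfl⟩
  rw [← hκ, ← hg]
  set E := ∫ x in (0 : ℝ)..1, q x ^ 2 with hE
  set N := ∫ x in (0 : ℝ)..1, f x ^ 2 with hN
  set J := ∫ x in (0 : ℝ)..1, x * q x * f x with hJ
  have ha := integral_id_mul f
  have htr : q 1 ^ 2 = E - 2 * J := sq_dirichletSolDeriv_one hf
  have h1 : ∫ x in (0 : ℝ)..1, 2 * f x * (x * g - f x) = 2 * g * (-q 1) - 2 * N := by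
    rw [← ha, ← intervalIntegral.integral_const_mul, hN, ← intervalIntegral.integral_const_mul,
      ← intervalIntegral.integral_sub (Continuous.intervalIntegrable (by fun_prop) _ _)
        (Continuous.intervalIntegrable (by fun_prop) _ _)]
    congr 1
    ext x
    ring
  -- Expansion of `∫ (f + q(1) k)² ≥ 0`; it bounds the feedback term `-2 g q(1)` by `N + κ q(1)²`.
  have h2 : 0 ≤ N + 2 * q 1 * g + q 1 ^ 2 * κ := by
    have : ∫ x in (0 : ℝ)..1, (f x + q 1 * k x) ^ 2 = N + 2 * q 1 * g + q 1 ^ 2 * κ := by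
      rw [hN, hg, hκ, ← intervalIntegral.integral_const_mul, ← intervalIntegral.integral_const_mul,
        ← intervalIntegral.integral_add (Continuous.intervalIntegrable (by fun_prop) _ _)
        (Continuous.intervalIntegrable (by fun_prop) _ _),
        ← intervalIntegral.integral_add (Continuous.intervalIntegrable (by fun_prop) _ _)
        (Continuous.intervalIntegrable (by fun_prop) _ _)]
      congr 1
      ext x
      ring
    rw [← this]
    exact intervalIntegral.integral_nonneg zero_le_one fun x _ => sq_nonneg _
  -- Expansion of `∫ (f + κ x q)² ≥ 0`, where `x² q²` is enlarged to `q²` by the added nonnegative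
  -- term. It absorbs the `J` that the trace identity brings in.
  have h3 : 0 ≤ N + 2 * κ * J + κ ^ 2 * E := by
    have h4 : 0 ≤ ∫ x in (0 : ℝ)..1, ((f x + κ * x * q x) ^ 2 + κ ^ 2 * ((1 - x ^ 2) * q x ^ 2)) := by
      refine intervalIntegral.integral_nonneg zero_le_one fun x hx => ?_
      have : 0 ≤ 1 - x ^ 2 := by nlinarith [hx.1, hx.2]
      positivity
    have : ∫ x in (0 : ℝ)..1, ((f x + κ * x * q x) ^ 2 + κ ^ 2 * ((1 - x ^ 2) * q x ^ 2))
        = N + 2 * κ * J + κ ^ 2 * E := by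
      rw [hN, hJ, hE, ← intervalIntegral.integral_const_mul, ← intervalIntegral.integral_const_mul,
        ← intervalIntegral.integral_add (Continuous.intervalIntegrable (by fun_prop) _ _)
        (Continuous.intervalIntegrable (by fun_prop) _ _),
        ← intervalIntegral.integral_add (Continuous.intervalIntegrable (by fun_prop) _ _)
        (Continuous.intervalIntegrable (by fun_prop) _ _)]
      congr 1
      ext x
      ring
    rwa [this] at h4
  rw [h1]
  rw [htr] at h2
  nlinarith

/-- Expanding `∫₀ˣ (f - p)² ≥ 0` with `p` the value of the primitive at `x` gives `(2 - x) p² ≤ ∫₀ˣ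
f²`, and `2 - x ≥ 1`. -/
theorem sq_primitive_le (hf : Continuous f) {x : ℝ} (hx : x ∈ Icc (0 : ℝ) 1) :
    primitive f x ^ 2 ≤ ∫ ξ in (0 : ℝ)..1, f ξ ^ 2 := by
  set p := primitive f x with hp
  have h1 : 0 ≤ ∫ ξ in (0 : ℝ)..x, (f ξ - p) ^ 2 :=
    intervalIntegral.integral_nonneg hx.1 fun _ _ => sq_nonneg _
  have h2 : ∫ ξ in (0 : ℝ)..x, (f ξ - p) ^ 2
      = (∫ ξ in (0 : ℝ)..x, f ξ ^ 2) - 2 * p * p + x * p ^ 2 := by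
    have h3 : ∫ ξ in (0 : ℝ)..x, p ^ 2 = x * p ^ 2 := by simp
    conv_rhs => rw [← h3]; enter [1, 2, 2]; rw [hp, primitive]
    rw [← intervalIntegral.integral_const_mul,
      ← intervalIntegral.integral_sub (Continuous.intervalIntegrable (by fun_prop) _ _)
        (Continuous.intervalIntegrable (by fun_prop) _ _),
      ← intervalIntegral.integral_add (Continuous.intervalIntegrable (by fun_prop) _ _)
        (Continuous.intervalIntegrable (by fun_prop) _ _)]
    congr 1
    ext ξ
    ring
  have h4 : ∫ ξ in (0 : ℝ)..x, f ξ ^ 2 ≤ ∫ ξ in (0 : ℝ)..1, f ξ ^ 2 :=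
    intervalIntegral.integral_mono_interval le_rfl hx.1 hx.2
      (Eventually.of_forall fun _ => sq_nonneg _) (Continuous.intervalIntegrable (by fun_prop) _ _)
  nlinarith [hx.1, hx.2, sq_nonneg p]

/-- `w'` is the mean of the primitive minus the primitive, so the left side is a variance, at most
the second moment. This makes the energy vanish initially. -/
theorem integral_sq_dirichletSolDeriv_le (hf : Continuous f) :
    ∫ x in (0 : ℝ)..1, dirichletSolDeriv f x ^ 2 ≤ ∫ ξ in (0 : ℝ)..1, f ξ ^ 2 := by
  have hp := continuous_primitive hf
  have hm : ∫ x in (0 : ℝ)..1, primitive f x = secondPrimitive f 1 := by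
    rw [intervalIntegral.integral_eq_sub_of_hasDerivAt
      (fun x _ => hasDerivAt_secondPrimitive hf x) (hp.intervalIntegrable _ _)]
    simp [secondPrimitive, primitive]
  have h1 : ∫ x in (0 : ℝ)..1, dirichletSolDeriv f x ^ 2
      = (∫ x in (0 : ℝ)..1, primitive f x ^ 2) - secondPrimitive f 1 ^ 2 := by
    have h3 : ∫ x in (0 : ℝ)..1, secondPrimitive f 1 ^ 2 = secondPrimitive f 1 ^ 2 := by simp
    have h4 : (∫ x in (0 : ℝ)..1, primitive f x ^ 2) - secondPrimitive f 1 ^ 2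
      = (∫ x in (0 : ℝ)..1, primitive f x ^ 2)
        - 2 * secondPrimitive f 1 * (∫ x in (0 : ℝ)..1, primitive f x)
        + ∫ x in (0 : ℝ)..1, secondPrimitive f 1 ^ 2 := by rw [h3, hm]; ring
    rw [h4, ← intervalIntegral.integral_const_mul,
      ← intervalIntegral.integral_sub (Continuous.intervalIntegrable (by fun_prop) _ _)
        (Continuous.intervalIntegrable (by fun_prop) _ _),
      ← intervalIntegral.integral_add (Continuous.intervalIntegrable (by fun_prop) _ _)
        (Continuous.intervalIntegrable (by fun_prop) _ _)]
    congr 1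
    ext ξ
    simp only [dirichletSolDeriv]
    ring
  have h2 : ∫ x in (0 : ℝ)..1, primitive f x ^ 2
      ≤ ∫ _ in (0 : ℝ)..1, ∫ ξ in (0 : ℝ)..1, f ξ ^ 2 :=
    intervalIntegral.integral_mono_on zero_le_one (Continuous.intervalIntegrable (by fun_prop) _ _)
      (by simp) fun x hx => sq_primitive_le hf hx
  simp only [intervalIntegral.integral_const, sub_zero, one_smul] at h2
  nlinarith [sq_nonneg (secondPrimitive f 1)]

/-- A continuous `f` vanishes on `(0,1)` as soon as the solution of `-w'' = f` does. -/
theorem eq_zero_of_integral_sq_dirichletSolDeriv (hf : Continuous f)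
    (h0 : ∫ x in (0 : ℝ)..1, dirichletSolDeriv f x ^ 2 = 0) {x : ℝ} (hx : x ∈ Ioo (0 : ℝ) 1) :
    f x = 0 := by
  have hq := continuous_dirichletSolDeriv hf
  have h1 : ∀ y ∈ Ioo (0 : ℝ) 1, dirichletSolDeriv f y = 0 := by
    intro y hy
    by_contra hne
    have : 0 < ∫ x in (0 : ℝ)..1, dirichletSolDeriv f x ^ 2 :=
      intervalIntegral.integral_pos zero_lt_one (by fun_prop) (fun _ _ => sq_nonneg _)
        ⟨y, ⟨hy.1.le, hy.2.le⟩, by positivity⟩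
    exact this.ne' h0
  have h2 : HasDerivAt (dirichletSolDeriv f) 0 x := by
    refine (hasDerivAt_const x (0 : ℝ)).congr_of_eventuallyEq ?_
    filter_upwards [Ioo_mem_nhds hx.1 hx.2] with y hy using h1 y hy
  have := (hasDerivAt_dirichletSolDeriv hf x).unique h2
  linarith

end OneVariable

/-! ### Uniqueness for the heat equation with a nonlocal boundary condition -/

/-- The base point is interior because `h'` need not extend to the endpoints. -/
theorem taylor_integral_remainder {h : ℝ → ℝ} (hh : ContDiffOn ℝ 2 h (Ioo 0 1)) {a x : ℝ}
    (ha : a ∈ Ioo (0 : ℝ) 1) (hx : x ∈ Ioo (0 : ℝ) 1) :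
    h x - h a - deriv h a * (x - a) = ∫ ξ in a..x, (x - ξ) * iteratedDeriv 2 h ξ := by
  have hsub : uIcc a x ⊆ Ioo (0 : ℝ) 1 := ordConnected_Ioo.uIcc_subset ha hx
  have e2 : iteratedDeriv 2 h = deriv (deriv h) := by
    rw [show (2 : ℕ) = 1 + 1 from rfl, iteratedDeriv_succ, iteratedDeriv_one]
  have h1 : ContDiffOn ℝ 1 (deriv h) (Ioo 0 1) :=
    ((contDiffOn_succ_iff_deriv_of_isOpen (n := 1) isOpen_Ioo).1
      (by simpa [one_add_one_eq_two] using hh)).2.2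
  have h2 : ContinuousOn (deriv (deriv h)) (Ioo 0 1) :=
    h1.continuousOn_deriv_of_isOpen isOpen_Ioo le_rfl
  have hd : ∀ ξ ∈ uIcc a x, HasDerivAt (fun ξ => (x - ξ) * deriv h ξ + h ξ)
      ((x - ξ) * deriv (deriv h) ξ) ξ := by
    intro ξ hξ
    have hn := isOpen_Ioo.mem_nhds (hsub hξ)
    have d1 : HasDerivAt h (deriv h ξ) ξ :=
      ((hh.differentiableOn (by norm_num)).differentiableAt hn).hasDerivAt
    have d2 : HasDerivAt (deriv h) (deriv (deriv h) ξ) ξ :=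
      ((h1.differentiableOn (by norm_num)).differentiableAt hn).hasDerivAt
    refine ((((hasDerivAt_id ξ).const_sub x).mul d2).add d1).congr_deriv ?_
    simp
  rw [e2, intervalIntegral.integral_eq_sub_of_hasDerivAt hd]
  · ring
  · exact (ContinuousOn.mul (by fun_prop) (h2.mono hsub)).intervalIntegrable

/-- A solution of the heat equation on `(0,1)` with zero left boundary value, continuous up to the
boundary and extended continuously to the whole line. -/
structure IsHeatFlow (z : ℝ → ℝ → ℝ) : Prop where
  continuousOn : ContinuousOn (fun p : ℝ × ℝ => z p.1 p.2) (univ ×ˢ Ioi 0)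
  contDiffOn : ∀ t : ℝ, 0 < t → ContDiffOn ℝ 2 (fun x => z x t) (Ioo 0 1)
  continuousOn_xx : ContinuousOn
    (fun p : ℝ × ℝ => iteratedDeriv 2 (fun x => z x p.2) p.1) (Ioo 0 1 ×ˢ Ioi 0)
  pde : ∀ x ∈ Ioo (0 : ℝ) 1, ∀ t : ℝ, 0 < t →
    HasDerivAt (fun s => z x s) (iteratedDeriv 2 (fun y => z y t) x) t
  left_boundary : ∀ t : ℝ, 0 < t → z 0 t = 0

namespace IsHeatFlow

variable {z : ℝ → ℝ → ℝ} {s t x a : ℝ}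

theorem continuous_space (hz : IsHeatFlow z) (ht : 0 < t) : Continuous fun x => z x t := by
  rw [← continuousOn_univ]
  exact hz.continuousOn.comp (f := fun x => (x, t)) (by fun_prop) fun x _ => ⟨mem_univ _, ht⟩

theorem continuousOn_time (hz : IsHeatFlow z) (x : ℝ) : ContinuousOn (fun t => z x t) (Ioi 0) :=
  hz.continuousOn.comp (f := fun t => (x, t)) (by fun_prop) fun _ ht => ⟨mem_univ _, ht⟩

theorem uIcc_subset (hs : 0 < s) (ht : 0 < t) : uIcc s t ⊆ Ioi (0 : ℝ) :=
  ordConnected_Ioi.uIcc_subset hs ht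

theorem intervalIntegrable_time (hz : IsHeatFlow z) (hs : 0 < s) (ht : 0 < t) (x : ℝ) :
    IntervalIntegrable (fun r => z x r) volume s t :=
  ((hz.continuousOn_time x).mono (uIcc_subset hs ht)).intervalIntegrable

theorem continuous_integral_time (hz : IsHeatFlow z) (hs : 0 < s) (ht : 0 < t) :
    Continuous fun x => ∫ r in s..t, z x r := by
  rw [continuous_iff_continuousAt]
  intro x
  have hK : IsCompact (Icc (x - 1) (x + 1) ×ˢ uIcc s t) := isCompact_Icc.prod isCompact_uIcc
  obtain ⟨M, hM⟩ := hK.exists_bound_of_continuousOn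
    (hz.continuousOn.mono (prod_mono (subset_univ _) (uIcc_subset hs ht)))
  refine intervalIntegral.continuousAt_of_dominated_interval (bound := fun _ => M) ?_ ?_
    (by simp) ?_
  · refine Eventually.of_forall fun y => ?_
    exact (hz.intervalIntegrable_time hs ht y).aestronglyMeasurable_restrict_uIoc
  · filter_upwards [Icc_mem_nhds (sub_one_lt x) (lt_add_one x)] with y hy
    exact Eventually.of_forall fun r hr => hM (y, r) ⟨hy, uIoc_subset_uIcc hr⟩
  · exact Eventually.of_forall fun r hr =>
      (hz.continuous_space (uIcc_subset hs ht (uIoc_subset_uIcc hr))).continuousAt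

theorem integral_xx_time (hz : IsHeatFlow z) (hs : 0 < s) (ht : 0 < t) (hx : x ∈ Ioo (0 : ℝ) 1) :
    ∫ r in s..t, iteratedDeriv 2 (fun y => z y r) x = z x t - z x s := by
  refine intervalIntegral.integral_eq_sub_of_hasDerivAt
    (fun r hr => hz.pde x hx r (uIcc_subset hs ht hr)) (ContinuousOn.intervalIntegrable ?_)
  exact hz.continuousOn_xx.comp (f := fun r => (x, r)) (by fun_prop)
    fun r hr => ⟨hx, uIcc_subset hs ht hr⟩

theorem integrableOn_remainder (hz : IsHeatFlow z) (hs : 0 < s) (ht : 0 < t)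
    (ha : a ∈ Ioo (0 : ℝ) 1) (hx : x ∈ Ioo (0 : ℝ) 1) :
    IntegrableOn (Function.uncurry fun r ξ => (x - ξ) * iteratedDeriv 2 (fun y => z y r) ξ)
      (uIoc s t ×ˢ uIoc a x) := by
  refine IntegrableOn.mono_set (t := uIcc s t ×ˢ uIcc a x) ?_
    (prod_mono uIoc_subset_uIcc uIoc_subset_uIcc)
  refine ContinuousOn.integrableOn_compact (isCompact_uIcc.prod isCompact_uIcc) ?_
  refine ContinuousOn.mul (by fun_prop) ?_
  exact hz.continuousOn_xx.comp (f := fun p : ℝ × ℝ => (p.2, p.1)) (by fun_prop)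
    fun p hp => ⟨ordConnected_Ioo.uIcc_subset ha hx hp.2, uIcc_subset hs ht hp.1⟩

/-- Fubini's theorem, then `z_xx = z_t` integrated in time. -/
theorem integral_remainder (hz : IsHeatFlow z) (hs : 0 < s) (ht : 0 < t)
    (ha : a ∈ Ioo (0 : ℝ) 1) (hx : x ∈ Ioo (0 : ℝ) 1) :
    ∫ r in s..t, ∫ ξ in a..x, (x - ξ) * iteratedDeriv 2 (fun y => z y r) ξ
      = ∫ ξ in a..x, (x - ξ) * (z ξ t - z ξ s) := by
  rw [intervalIntegral_intervalIntegral_swap (hz.integrableOn_remainder hs ht ha hx)]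
  refine intervalIntegral.integral_congr fun ξ hξ => ?_
  rw [intervalIntegral.integral_const_mul,
    hz.integral_xx_time hs ht (ordConnected_Ioo.uIcc_subset ha hx hξ)]

theorem intervalIntegrable_remainder (hz : IsHeatFlow z) (hs : 0 < s) (ht : 0 < t)
    (ha : a ∈ Ioo (0 : ℝ) 1) (hx : x ∈ Ioo (0 : ℝ) 1) :
    IntervalIntegrable
      (fun r => ∫ ξ in a..x, (x - ξ) * iteratedDeriv 2 (fun y => z y r) ξ) volume s t := by
  rw [intervalIntegrable_iff]
  have h1 := hz.integrableOn_remainder hs ht ha hx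
  rw [IntegrableOn, Measure.volume_eq_prod, ← Measure.prod_restrict] at h1
  have h2 := h1.integral_prod_left
  simp only [intervalIntegral.intervalIntegral_eq_integral_uIoc]
  exact h2.smul (if a ≤ x then (1 : ℝ) else -1)

/-- The Taylor expansions at `a` of the time average at two points `x` and `b`, with the first
derivative eliminated. -/
theorem interior_identity (hz : IsHeatFlow z) (hs : 0 < s) (ht : 0 < t) {b : ℝ}
    (ha : a ∈ Ioo (0 : ℝ) 1) (hx : x ∈ Ioo (0 : ℝ) 1) (hb : b ∈ Ioo (0 : ℝ) 1) :
    (b - a) * ((∫ r in s..t, z x r) - (∫ r in s..t, z a r)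
        - ∫ ξ in a..x, (x - ξ) * (z ξ t - z ξ s))
      = (x - a) * ((∫ r in s..t, z b r) - (∫ r in s..t, z a r)
        - ∫ ξ in a..b, (b - ξ) * (z ξ t - z ξ s)) := by
  have hi := hz.intervalIntegrable_time hs ht
  rw [← hz.integral_remainder hs ht ha hx, ← hz.integral_remainder hs ht ha hb,
    ← intervalIntegral.integral_sub (hi _) (hi _), ← intervalIntegral.integral_sub (hi _) (hi _),
    ← intervalIntegral.integral_sub ((hi _).sub (hi _))
      (hz.intervalIntegrable_remainder hs ht ha hx),
    ← intervalIntegral.integral_sub ((hi _).sub (hi _))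
      (hz.intervalIntegrable_remainder hs ht ha hb),
    ← intervalIntegral.integral_const_mul, ← intervalIntegral.integral_const_mul]
  refine intervalIntegral.integral_congr fun r hr => ?_
  have hr0 := uIcc_subset hs ht hr
  have h1 := taylor_integral_remainder (hz.contDiffOn r hr0) ha hx
  have h2 := taylor_integral_remainder (hz.contDiffOn r hr0) ha hb
  simp only [← h1, ← h2]
  ring

theorem integral_sub_mul_eq {f : ℝ → ℝ} (hf : Continuous f) (a x : ℝ) :
    ∫ ξ in a..x, (x - ξ) * f ξ = x * (primitive f x - primitive f a)
      - (primitive (fun ξ => ξ * f ξ) x - primitive (fun ξ => ξ * f ξ) a) := by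
  have hi : ∀ (g : ℝ → ℝ), Continuous g → ∀ u v, IntervalIntegrable g volume u v :=
    fun g hg u v => hg.intervalIntegrable u v
  simp only [primitive]
  rw [intervalIntegral.integral_interval_sub_left (hi _ hf _ _) (hi _ hf _ _),
    intervalIntegral.integral_interval_sub_left (hi _ (by fun_prop) _ _) (hi _ (by fun_prop) _ _),
    ← intervalIntegral.integral_const_mul,
    ← intervalIntegral.integral_sub (hi _ (by fun_prop) _ _) (hi _ (by fun_prop) _ _)]
  simp only [sub_mul]

/-- The time-integrated form of `w_t = x z(1,t) - z`. It is the limit `a → 0⁺` of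
`interior_identity` with `b = 1 - a`; the unknown derivative at `a` has been eliminated, so
continuity up to the boundary suffices. -/
theorem dirichletSol_sub_dirichletSol (hz : IsHeatFlow z) (hs : 0 < s) (ht : 0 < t)
    (hx : x ∈ Icc (0 : ℝ) 1) :
    dirichletSol (fun ξ => z ξ t) x - dirichletSol (fun ξ => z ξ s) x
      = x * (∫ r in s..t, z 1 r) - ∫ r in s..t, z x r := by
  have h0 : ∫ r in s..t, z 0 r = 0 := by
    rw [intervalIntegral.integral_congr (g := fun _ => (0 : ℝ))
      fun r hr => hz.left_boundary r (uIcc_subset hs ht hr)]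
    simp
  rcases eq_or_lt_of_le hx.1 with rfl | hx0
  · simp [dirichletSol_zero, h0]
  rcases eq_or_lt_of_le hx.2 with rfl | hx1
  · simp [dirichletSol_one]
  have hct := hz.continuous_space ht
  have hcs := hz.continuous_space hs
  rw [← dirichletSol_sub hct hcs]
  set d : ℝ → ℝ := fun ξ => z ξ t - z ξ s with hd
  have hdc : Continuous d := hct.sub hcs
  have hZ := hz.continuous_integral_time hs ht
  set Z : ℝ → ℝ := fun x => ∫ r in s..t, z x r with hZd
  have hP := continuous_primitive hdc
  have hR := continuous_primitive (f := fun ξ => ξ * d ξ) (by fun_prop)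
  have key : ∀ a ∈ Ioo (0 : ℝ) (1 / 2),
      (1 - a - a) * (Z x - Z a - (x * (primitive d x - primitive d a)
        - (primitive (fun ξ => ξ * d ξ) x - primitive (fun ξ => ξ * d ξ) a)))
      = (x - a) * (Z (1 - a) - Z a - ((1 - a) * (primitive d (1 - a) - primitive d a)
        - (primitive (fun ξ => ξ * d ξ) (1 - a) - primitive (fun ξ => ξ * d ξ) a))) := by
    intro a ha
    rw [← integral_sub_mul_eq hdc, ← integral_sub_mul_eq hdc]
    exact hz.interior_identity hs ht ⟨ha.1, by linarith [ha.2]⟩ ⟨hx0, hx1⟩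
      ⟨by linarith [ha.2], by linarith [ha.1]⟩
  have hev : ∀ᶠ a in 𝓝[>] (0 : ℝ), a ∈ Ioo (0 : ℝ) (1 / 2) := Ioo_mem_nhdsGT (by norm_num)
  have hl := tendsto_nhds_unique_of_eventuallyEq
    (((by fun_prop : Continuous fun a => (1 - a - a) * (Z x - Z a
      - (x * (primitive d x - primitive d a)
        - (primitive (fun ξ => ξ * d ξ) x - primitive (fun ξ => ξ * d ξ) a)))).tendsto
        0).mono_left nhdsWithin_le_nhds)
    (((by fun_prop : Continuous fun a => (x - a) * (Z (1 - a) - Z a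
      - ((1 - a) * (primitive d (1 - a) - primitive d a)
        - (primitive (fun ξ => ξ * d ξ) (1 - a)
          - primitive (fun ξ => ξ * d ξ) a)))).tendsto 0).mono_left nhdsWithin_le_nhds)
    (hev.mono fun a ha => key a ha)
  have hP0 : ∀ g : ℝ → ℝ, primitive g 0 = 0 := fun g => by simp [primitive]
  have hZ0 : Z 0 = 0 := h0
  simp only [sub_zero, hP0, hZ0, one_mul] at hl
  change dirichletSol d x = x * Z 1 - Z x
  simp only [dirichletSol, secondPrimitive]
  linarith

/-! ### Evolution of the `H⁻¹` energy -/

/-- The squared `H⁻¹` norm of `z(·,t)`. -/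
def energy (z : ℝ → ℝ → ℝ) (t : ℝ) : ℝ :=
  ∫ x in (0 : ℝ)..1, z x t * dirichletSol (fun ξ => z ξ t) x

theorem energy_eq (hz : IsHeatFlow z) (ht : 0 < t) :
    energy z t = ∫ x in (0 : ℝ)..1, dirichletSolDeriv (fun ξ => z ξ t) x ^ 2 := by
  have h := hz.continuous_space ht
  rw [energy, integral_mul_dirichletSol h h]
  simp only [sq]

/-- By self-adjointness the cross terms of `∫ (w(s) - w(t)) (z(s) + z(t))` cancel. The energy can
then be differentiated without differentiating `z` in time. -/
theorem energy_sub_energy (hz : IsHeatFlow z) (hs : 0 < s) (ht : 0 < t) :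
    energy z s - energy z t = ∫ x in (0 : ℝ)..1,
      (x * (∫ r in t..s, z 1 r) - ∫ r in t..s, z x r) * (z x s + z x t) := by
  have hcs := hz.continuous_space hs
  have hct := hz.continuous_space ht
  have hws := continuous_dirichletSol hcs
  have hwt := continuous_dirichletSol hct
  have h1 : ∫ x in (0 : ℝ)..1,
      (x * (∫ r in t..s, z 1 r) - ∫ r in t..s, z x r) * (z x s + z x t)
      = ∫ x in (0 : ℝ)..1, ((z x s * dirichletSol (fun ξ => z ξ s) x
        - z x t * dirichletSol (fun ξ => z ξ t) x)
        + (z x t * dirichletSol (fun ξ => z ξ s) x - z x s * dirichletSol (fun ξ => z ξ t) x)) := by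
    refine intervalIntegral.integral_congr fun x hx => ?_
    rw [uIcc_of_le zero_le_one] at hx
    simp only [← hz.dirichletSol_sub_dirichletSol ht hs hx]
    ring
  have hsymm : ∫ x in (0 : ℝ)..1, z x t * dirichletSol (fun ξ => z ξ s) x
      = ∫ x in (0 : ℝ)..1, z x s * dirichletSol (fun ξ => z ξ t) x := by
    rw [integral_mul_dirichletSol hct hcs, integral_mul_dirichletSol hcs hct]
    simp only [mul_comm]
  rw [h1, intervalIntegral.integral_add (Continuous.intervalIntegrable (by fun_prop) _ _)
    (Continuous.intervalIntegrable (by fun_prop) _ _),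
    intervalIntegral.integral_sub (Continuous.intervalIntegrable (by fun_prop) _ _)
    (Continuous.intervalIntegrable (by fun_prop) _ _),
    intervalIntegral.integral_sub (Continuous.intervalIntegrable (by fun_prop) _ _)
    (Continuous.intervalIntegrable (by fun_prop) _ _), hsymm]
  simp [energy]

theorem hasDerivAt_integral_time (hz : IsHeatFlow z) (ht : 0 < t) (x : ℝ) :
    HasDerivAt (fun s => ∫ r in t..s, z x r) (z x t) t := by
  have hc := (hz.continuousOn_time x).continuousAt (Ioi_mem_nhds ht)
  exact intervalIntegral.integral_hasDerivAt_right (by simp)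
    ((hz.continuousOn_time x).stronglyMeasurableAtFilter isOpen_Ioi t ht) hc

theorem hasDerivAt_energy (hz : IsHeatFlow z) (ht : 0 < t) :
    HasDerivAt (energy z) (∫ x in (0 : ℝ)..1, 2 * z x t * (x * z 1 t - z x t)) t := by
  rw [hasDerivAt_iff_tendsto_slope]
  have hK : IsCompact (Icc (0 : ℝ) 1 ×ˢ Icc (t / 2) (2 * t)) := isCompact_Icc.prod isCompact_Icc
  have hsub : Icc (t / 2) (2 * t) ⊆ Ioi 0 := fun r hr => (half_pos ht).trans_le hr.1
  obtain ⟨M, hM⟩ := hK.exists_bound_of_continuousOn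
    (hz.continuousOn.mono (prod_mono (subset_univ _) hsub))
  have hnb : ∀ᶠ s in 𝓝[≠] t, s ∈ Icc (t / 2) (2 * t) ∧ s ≠ t :=
    (eventually_nhdsWithin_of_eventually_nhds
      (Icc_mem_nhds (by linarith) (by linarith))).and self_mem_nhdsWithin
  have htm : t ∈ Icc (t / 2) (2 * t) := ⟨by linarith, by linarith⟩
  -- With `|z| ≤ M` near time `t`, the averaged factor and the sum `z(s) + z(t)` are each at most
  -- `2M`, which gives the dominating constant.
  have hlim : Tendsto (fun s => ∫ x in (0 : ℝ)..1, (s - t)⁻¹ *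
      (x * (∫ r in t..s, z 1 r) - ∫ r in t..s, z x r) * (z x s + z x t)) (𝓝[≠] t)
      (𝓝 (∫ x in (0 : ℝ)..1, 2 * z x t * (x * z 1 t - z x t))) := by
    refine intervalIntegral.tendsto_integral_filter_of_dominated_convergence
      (fun _ => (2 * M) * (2 * M)) ?_ ?_ (by simp) ?_
    · filter_upwards [hnb] with s hs
      have hs0 : 0 < s := hsub hs.1
      have h1 := hz.continuous_integral_time ht hs0
      have h2 := hz.continuous_space hs0
      have h3 := hz.continuous_space ht
      exact Continuous.aestronglyMeasurable (by fun_prop)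
    · filter_upwards [hnb] with s hs
      refine Eventually.of_forall fun x hx => ?_
      rw [uIoc_of_le zero_le_one] at hx
      have hx' : x ∈ Icc (0 : ℝ) 1 := ⟨hx.1.le, hx.2⟩
      have hb : ∀ y ∈ Icc (0 : ℝ) 1, |∫ r in t..s, z y r| ≤ M * |s - t| := fun y hy =>
        intervalIntegral.norm_integral_le_of_norm_le_const fun r hr =>
          hM (y, r) ⟨hy, ordConnected_Icc.uIcc_subset htm hs.1 (uIoc_subset_uIcc hr)⟩
      have hM0 : 0 ≤ M := (norm_nonneg _).trans (hM (x, t) ⟨hx', htm⟩)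
      have hst : 0 < |s - t| := abs_pos.2 (sub_ne_zero.2 hs.2)
      have h1 : |x * (∫ r in t..s, z 1 r) - ∫ r in t..s, z x r| ≤ 2 * M * |s - t| := by
        refine (abs_sub _ _).trans ?_
        rw [abs_mul, abs_of_pos hx.1]
        have e1 := hb 1 (by simp)
        have e2 := hb x hx'
        have : x * |∫ r in t..s, z 1 r| ≤ 1 * |∫ r in t..s, z 1 r| :=
          mul_le_mul_of_nonneg_right hx.2 (abs_nonneg _)
        linarith
      have h2 : |z x s + z x t| ≤ 2 * M := by
        refine (abs_add_le _ _).trans ?_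
        have e1 : |z x s| ≤ M := hM (x, s) ⟨hx', hs.1⟩
        have e2 : |z x t| ≤ M := hM (x, t) ⟨hx', htm⟩
        linarith
      rw [Real.norm_eq_abs, abs_mul, abs_mul, abs_inv]
      refine mul_le_mul ?_ h2 (abs_nonneg _) (by positivity)
      rw [inv_mul_le_iff₀ hst]
      linarith
    · refine Eventually.of_forall fun x _ => ?_
      have h1 := hasDerivAt_iff_tendsto_slope.1
        (((hz.hasDerivAt_integral_time ht 1).const_mul x).sub (hz.hasDerivAt_integral_time ht x))
      have h2 : Tendsto (fun s => z x s + z x t) (𝓝[≠] t) (𝓝 (z x t + z x t)) :=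
        ((((hz.continuousOn_time x).continuousAt (Ioi_mem_nhds ht)).tendsto).add_const _).mono_left
          nhdsWithin_le_nhds
      refine ((h1.mul h2).congr fun s => ?_).trans_eq ?_
      · simp [slope_def_field, div_eq_inv_mul]
      · congr 1
        ring
  refine hlim.congr' ?_
  filter_upwards [hnb] with s hs
  rw [slope_def_field, hz.energy_sub_energy (hsub hs.1) ht, div_eq_inv_mul,
    ← intervalIntegral.integral_const_mul]
  simp only [mul_assoc]

/-- A heat flow driven by its own state through the right boundary value, with zero initial state,
vanishes. -/
theorem eq_zero (hz : IsHeatFlow z) {k : ℝ → ℝ} (hk : Continuous k)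
    (hright : ∀ t : ℝ, 0 < t → z 1 t = ∫ ξ in (0 : ℝ)..1, k ξ * z ξ t)
    (hinit : Tendsto (fun t => ∫ x in (0 : ℝ)..1, z x t ^ 2) (𝓝[>] 0) (𝓝 0))
    (hx : x ∈ Ioo (0 : ℝ) 1) (ht : 0 < t) : z x t = 0 := by
  set κ := ∫ x in (0 : ℝ)..1, k x ^ 2
  have hE0 : ∀ t, 0 < t → 0 ≤ energy z t := fun t ht => by
    rw [hz.energy_eq ht]
    exact intervalIntegral.integral_nonneg zero_le_one fun _ _ => sq_nonneg _
  have hderiv : ∀ t, 0 < t → ∫ x in (0 : ℝ)..1, 2 * z x t * (x * z 1 t - z x t)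
      ≤ (κ + κ ^ 2) * energy z t := fun t ht => by
    rw [hz.energy_eq ht, hright t ht]
    exact energy_inequality hk (hz.continuous_space ht)
  have hd : ∀ t ∈ Ioi (0 : ℝ), HasDerivAt (fun t => Real.exp (-(κ + κ ^ 2) * t) * energy z t)
      (Real.exp (-(κ + κ ^ 2) * t) * (-(κ + κ ^ 2)) * energy z t + Real.exp (-(κ + κ ^ 2) * t)
        * ∫ x in (0 : ℝ)..1, 2 * z x t * (x * z 1 t - z x t)) t := fun t ht => by
    have h1 : HasDerivAt (fun t => Real.exp (-(κ + κ ^ 2) * t))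
        (Real.exp (-(κ + κ ^ 2) * t) * (-(κ + κ ^ 2))) t := by
      generalize -(κ + κ ^ 2) = L
      simpa using ((hasDerivAt_id t).const_mul L).exp
    exact h1.mul (hz.hasDerivAt_energy ht)
  have hanti : AntitoneOn (fun t => Real.exp (-(κ + κ ^ 2) * t) * energy z t) (Ioi 0) := by
    refine antitoneOn_of_deriv_nonpos (convex_Ioi 0)
      (fun t ht => (hd t ht).continuousAt.continuousWithinAt)
      (fun t ht => ?_) fun t ht => ?_
    · rw [interior_Ioi] at ht
      exact (hd t ht).differentiableAt.differentiableWithinAt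
    · rw [interior_Ioi] at ht
      rw [(hd t ht).deriv]
      have := mul_le_mul_of_nonneg_left (hderiv t ht) (Real.exp_pos (-(κ + κ ^ 2) * t)).le
      linarith
  have hE : Tendsto (energy z) (𝓝[>] 0) (𝓝 0) := by
    refine squeeze_zero' ?_ ?_ hinit
    · filter_upwards [self_mem_nhdsWithin] with t ht using hE0 t ht
    · filter_upwards [self_mem_nhdsWithin] with t ht
      rw [hz.energy_eq ht]
      exact integral_sq_dirichletSolDeriv_le (hz.continuous_space ht)
  have hlim : Tendsto (fun t => Real.exp (-(κ + κ ^ 2) * t) * energy z t) (𝓝[>] 0) (𝓝 0) := by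
    have h1 : Tendsto (fun t : ℝ => Real.exp (-(κ + κ ^ 2) * t)) (𝓝[>] 0) (𝓝 1) := by
      have : Continuous fun t : ℝ => Real.exp (-(κ + κ ^ 2) * t) := by fun_prop
      simpa using (this.tendsto 0).mono_left nhdsWithin_le_nhds
    simpa using h1.mul hE
  -- A decreasing function lies below its limit at `0⁺`.
  have hle : Real.exp (-(κ + κ ^ 2) * t) * energy z t ≤ 0 := by
    refine ge_of_tendsto hlim ?_
    filter_upwards [Ioo_mem_nhdsGT ht] with s hs
    exact hanti hs.1 ht hs.2.le
  have hz0 : energy z t = 0 := by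
    have := hE0 t ht
    have h2 := Real.exp_pos (-(κ + κ ^ 2) * t)
    nlinarith
  exact eq_zero_of_integral_sq_dirichletSolDeriv (hz.continuous_space ht)
    (by rw [← hz.energy_eq ht, hz0]) hx

end IsHeatFlow

/-! ### The `L²` norm on the unit interval and uniqueness for the closed-loop system -/

instance : IsProbabilityMeasure unitMeasure :=
  ⟨by simp [unitMeasure]⟩

theorem integral_unitMeasure (f : ℝ → ℝ) :
    ∫ x, f x ∂unitMeasure = ∫ x in (0 : ℝ)..1, f x := by
  rw [intervalIntegral.integral_of_le zero_le_one, unitMeasure, integral_Icc_eq_integral_Ioc]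

theorem memLp_of_continuousOn {f : ℝ → ℝ} (hf : ContinuousOn f (Icc 0 1)) :
    MemLp f 2 unitMeasure := by
  obtain ⟨M, hM⟩ := isCompact_Icc.exists_bound_of_continuousOn hf
  exact MemLp.of_bound (hf.aestronglyMeasurable measurableSet_Icc) M
    ((ae_restrict_iff' measurableSet_Icc).2 (Eventually.of_forall hM))

theorem toReal_normL2_sq {f : ℝ → ℝ} (hf : MemLp f 2 unitMeasure) :
    (normL2 f).toReal ^ 2 = ∫ x in (0 : ℝ)..1, f x ^ 2 := by
  have h0 : 0 ≤ ∫ x, f x ^ 2 ∂unitMeasure := integral_nonneg fun _ => sq_nonneg _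
  have h1 : normL2 f = ENNReal.ofReal (Real.sqrt (∫ x, f x ^ 2 ∂unitMeasure)) := by
    rw [normL2, hf.eLpNorm_eq_integral_rpow_norm (by norm_num) (by norm_num), Real.sqrt_eq_rpow]
    simp
  rw [h1, ENNReal.toReal_ofReal (Real.sqrt_nonneg _), Real.sq_sqrt h0, integral_unitMeasure]

/-- The projection of the real line onto the unit interval. -/
def clamp (x : ℝ) : ℝ := max 0 (min 1 x)

theorem continuous_clamp : Continuous clamp := by unfold clamp; fun_prop

theorem clamp_mem (x : ℝ) : clamp x ∈ Icc (0 : ℝ) 1 := by simp [clamp]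

theorem clamp_of_mem {x : ℝ} (hx : x ∈ Icc (0 : ℝ) 1) : clamp x = x := by
  simp [clamp, hx.1, hx.2]

namespace IsClosedLoopSolution

variable {c : ℝ} {k y₀ : ℝ → ℝ} {y y₁ y₂ : ℝ → ℝ → ℝ} {t x : ℝ}

theorem continuousOn_space (hy : IsClosedLoopSolution c k y₀ y) (ht : 0 < t) :
    ContinuousOn (fun x => y x t) (Icc 0 1) :=
  hy.continuousOn.comp (f := fun x => (x, t)) (by fun_prop) fun _ hx => ⟨hx, ht⟩

theorem iteratedDeriv_difference (h₁ : IsClosedLoopSolution c k y₀ y₁)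
    (h₂ : IsClosedLoopSolution c k y₀ y₂) (ht : 0 < t) (hx : x ∈ Ioo (0 : ℝ) 1) (a : ℝ) :
    iteratedDeriv 2 (fun x => a * (y₁ (clamp x) t - y₂ (clamp x) t)) x
      = a * (iteratedDeriv 2 (fun x => y₁ x t) x - iteratedDeriv 2 (fun x => y₂ x t) x) := by
  have hn := isOpen_Ioo.mem_nhds hx
  have e : (fun x => a * (y₁ (clamp x) t - y₂ (clamp x) t))
      =ᶠ[𝓝 x] fun x => a * (y₁ x t - y₂ x t) := by
    filter_upwards [hn] with x hx
    rw [clamp_of_mem ⟨hx.1.le, hx.2.le⟩]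
  have c1 : ContDiffAt ℝ 2 (fun x => y₁ x t) x := (h₁.contDiffOn t ht).contDiffAt hn
  have c2 : ContDiffAt ℝ 2 (fun x => y₂ x t) x := (h₂.contDiffOn t ht).contDiffAt hn
  rw [(e.iteratedDeriv_eq 2), iteratedDeriv_const_mul_field, iteratedDeriv_fun_sub c1 c2]

/-- The factor `e^{-ct}` removes the term `c y`; composing with `clamp` makes the space functions
continuous on the whole line. -/
theorem isHeatFlow_difference (h₁ : IsClosedLoopSolution c k y₀ y₁)
    (h₂ : IsClosedLoopSolution c k y₀ y₂) :
    IsHeatFlow fun x t => Real.exp (-c * t) * (y₁ (clamp x) t - y₂ (clamp x) t) where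
  continuousOn := by
    have hcl : ContinuousOn (fun p : ℝ × ℝ => (clamp p.1, p.2)) (univ ×ˢ Ioi 0) :=
      ((continuous_clamp.comp continuous_fst).prodMk continuous_snd).continuousOn
    have hm : MapsTo (fun p : ℝ × ℝ => (clamp p.1, p.2)) (univ ×ˢ Ioi 0) (Icc 0 1 ×ˢ Ioi 0) :=
      fun p hp => ⟨clamp_mem _, hp.2⟩
    exact ContinuousOn.mul (by fun_prop)
      ((h₁.continuousOn.comp hcl hm).sub (h₂.continuousOn.comp hcl hm))
  contDiffOn t ht := by
    refine ((contDiffOn_const (c := Real.exp (-c * t))).mul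
      ((h₁.contDiffOn t ht).sub (h₂.contDiffOn t ht))).congr fun x hx => ?_
    rw [clamp_of_mem ⟨hx.1.le, hx.2.le⟩]
  continuousOn_xx := by
    refine (ContinuousOn.mul (f := fun p : ℝ × ℝ => Real.exp (-c * p.2)) (by fun_prop)
      (h₁.continuousOn_xx.sub h₂.continuousOn_xx)).congr
      fun p hp => ?_
    exact iteratedDeriv_difference h₁ h₂ hp.2 hp.1 _
  pde x hx t ht := by
    rw [iteratedDeriv_difference h₁ h₂ ht hx]
    have he : HasDerivAt (fun t => Real.exp (-c * t)) (Real.exp (-c * t) * -c) t := by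
      simpa using ((hasDerivAt_id t).const_mul (-c)).exp
    simp only [clamp_of_mem (show x ∈ Icc (0 : ℝ) 1 from ⟨hx.1.le, hx.2.le⟩)]
    refine (he.mul ((h₁.pde x hx t ht).sub (h₂.pde x hx t ht))).congr_deriv ?_
    simp only [Pi.sub_apply]
    ring
  left_boundary t ht := by
    simp [clamp_of_mem (show (0 : ℝ) ∈ Icc (0 : ℝ) 1 by simp), h₁.left_boundary t ht,
      h₂.left_boundary t ht]

theorem tendsto_integral_sq_difference (h₁ : IsClosedLoopSolution c k y₀ y₁)
    (h₂ : IsClosedLoopSolution c k y₀ y₂) (hy₀ : MemLp y₀ 2 unitMeasure) :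
    Tendsto (fun t => ∫ x in (0 : ℝ)..1, (y₁ x t - y₂ x t) ^ 2) (𝓝[>] 0) (𝓝 0) := by
  have h3 : Tendsto (fun t => normL2 fun x => y₁ x t - y₂ x t) (𝓝[>] 0) (𝓝 0) := by
    have hadd := h₁.initial.add h₂.initial
    rw [add_zero] at hadd
    refine tendsto_of_tendsto_of_tendsto_of_le_of_le' tendsto_const_nhds hadd
      (Eventually.of_forall fun _ => zero_le) ?_
    filter_upwards [self_mem_nhdsWithin] with t ht
    have m1 := memLp_of_continuousOn (h₁.continuousOn_space ht)
    have m2 := memLp_of_continuousOn (h₂.continuousOn_space ht)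
    refine le_trans (le_of_eq ?_) (eLpNorm_sub_le (m1.sub hy₀).1 (m2.sub hy₀).1 one_le_two)
    unfold normL2
    congr 1
    ext x
    simp
  have h4 := ((ENNReal.tendsto_toReal ENNReal.zero_ne_top).comp h3).pow 2
  simp only [ENNReal.toReal_zero, ne_eq, OfNat.ofNat_ne_zero, not_false_eq_true, zero_pow] at h4
  refine h4.congr' ?_
  filter_upwards [self_mem_nhdsWithin] with t ht
  exact toReal_normL2_sq (memLp_of_continuousOn
    ((h₁.continuousOn_space ht).sub (h₂.continuousOn_space ht)))

theorem right_boundary_difference (h₁ : IsClosedLoopSolution c k y₀ y₁)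
    (h₂ : IsClosedLoopSolution c k y₀ y₂) (hk : Continuous k) (ht : 0 < t) :
    y₁ 1 t - y₂ 1 t = ∫ ξ in (0 : ℝ)..1, k ξ * (y₁ ξ t - y₂ ξ t) := by
  have hi : ∀ {y}, IsClosedLoopSolution c k y₀ y →
      IntervalIntegrable (fun ξ => k ξ * y ξ t) volume 0 1 := fun h =>
    ContinuousOn.intervalIntegrable (hk.continuousOn.mul
      ((h.continuousOn_space ht).mono (uIcc_of_le zero_le_one).subset))
  rw [h₁.right_boundary t ht, h₂.right_boundary t ht, ← intervalIntegral.integral_sub (hi h₁) (hi h₂)]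
  simp only [mul_sub]

/-- The closed-loop system has at most one solution. -/
theorem unique (h₁ : IsClosedLoopSolution c k y₀ y₁) (h₂ : IsClosedLoopSolution c k y₀ y₂)
    (hk : Continuous k) (hy₀ : MemLp y₀ 2 unitMeasure) (hx : x ∈ Icc (0 : ℝ) 1) (ht : 0 < t) :
    y₁ x t = y₂ x t := by
  have hone : clamp 1 = 1 := clamp_of_mem (by simp)
  have hcongr : ∀ (F : ℝ → ℝ → ℝ) (t : ℝ),
      ∫ x in (0 : ℝ)..1, F x (Real.exp (-c * t) * (y₁ (clamp x) t - y₂ (clamp x) t))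
        = ∫ x in (0 : ℝ)..1, F x (Real.exp (-c * t) * (y₁ x t - y₂ x t)) := fun F t =>
    intervalIntegral.integral_congr fun x hx => by
      rw [uIcc_of_le zero_le_one] at hx
      simp only [clamp_of_mem hx]
  have hint : ∀ x ∈ Ioo (0 : ℝ) 1, y₁ x t = y₂ x t := fun x hx => by
    have h0 := (isHeatFlow_difference h₁ h₂).eq_zero hk (fun t ht => ?_) ?_ hx ht
    · rw [clamp_of_mem ⟨hx.1.le, hx.2.le⟩] at h0
      exact sub_eq_zero.1 ((mul_eq_zero.1 h0).resolve_left (Real.exp_pos _).ne')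
    · rw [hcongr fun x z => k x * z]
      simp only [hone, right_boundary_difference h₁ h₂ hk ht, mul_left_comm (k _),
        intervalIntegral.integral_const_mul]
    · have h3 : Tendsto (fun t : ℝ => Real.exp (-c * t) ^ 2) (𝓝[>] 0) (𝓝 1) := by
        have : Continuous fun t : ℝ => Real.exp (-c * t) ^ 2 := by fun_prop
        simpa using (this.tendsto 0).mono_left nhdsWithin_le_nhds
      have h4 := h3.mul (tendsto_integral_sq_difference h₁ h₂ hy₀)
      rw [mul_zero] at h4
      refine h4.congr fun t => ?_
      rw [hcongr fun _ z => z ^ 2, ← intervalIntegral.integral_const_mul]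
      simp only [mul_pow]
  rcases eq_or_lt_of_le hx.1 with rfl | hx0
  · rw [h₁.left_boundary t ht, h₂.left_boundary t ht]
  rcases eq_or_lt_of_le hx.2 with rfl | hx1
  -- The value at `1` is an integral of the interior values, already known to agree.
  · rw [← sub_eq_zero, right_boundary_difference h₁ h₂ hk ht]
    have hc : ContinuousOn (fun ξ => y₁ ξ t - y₂ ξ t) (Icc 0 1) :=
      (h₁.continuousOn_space ht).sub (h₂.continuousOn_space ht)
    rw [intervalIntegral.integral_of_le zero_le_one, integral_Ioc_eq_integral_Ioo,
      setIntegral_congr_fun (g := fun _ => (0 : ℝ)) measurableSet_Ioo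
      (fun ξ hξ => by simp [hint ξ hξ])]
    simp
  · exact hint x ⟨hx0, hx1⟩

end IsClosedLoopSolution

/-! ### Roots of the characteristic equation -/

section Roots

variable {θ₁ θ₂ β γ : ℝ}

/-- The derivative of `charLHS`. -/
def charDeriv (θ₁ θ₂ β : ℝ) : ℝ :=
  (2 * (θ₁ + θ₂) * β - (θ₁ + 2 * θ₂) * β + β ^ 3) * Real.cos β
    + (3 * β ^ 2 - (θ₁ + 2 * θ₂) - ((θ₁ + θ₂) * β ^ 2 - 2 * θ₂)) * Real.sin β

theorem hasDerivAt_charLHS (θ₁ θ₂ β : ℝ) :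
    HasDerivAt (charLHS θ₁ θ₂) (charDeriv θ₁ θ₂ β) β := by
  have hA : HasDerivAt (fun β : ℝ => θ₁ * β ^ 2 + θ₂ * β ^ 2 - 2 * θ₂)
      (θ₁ * (2 * β) + θ₂ * (2 * β)) β := by
    have := (((hasDerivAt_pow 2 β).const_mul θ₁).add
      ((hasDerivAt_pow 2 β).const_mul θ₂)).sub_const (2 * θ₂)
    simpa using this
  have hB : HasDerivAt (fun β : ℝ => β ^ 3 - θ₁ * β - 2 * θ₂ * β)
      (3 * β ^ 2 - θ₁ - 2 * θ₂) β := by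
    refine (((hasDerivAt_pow 3 β).sub ((hasDerivAt_id β).const_mul θ₁)).sub
      ((hasDerivAt_id β).const_mul (2 * θ₂))).congr_deriv ?_
    simp
  refine (((hA.mul (Real.hasDerivAt_cos β)).add (hB.mul (Real.hasDerivAt_sin β))).add_const
    (2 * θ₂)).congr_deriv ?_
  simp only [charDeriv]
  ring

/-- A constant bounding the lower-order terms of the characteristic equation. -/
def charBound (θ₁ θ₂ : ℝ) : ℝ := 3 + 10 * (|θ₁| + |θ₂|)

theorem three_le_charBound (θ₁ θ₂ : ℝ) : 3 ≤ charBound θ₁ θ₂ := by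
  have := abs_nonneg θ₁
  have := abs_nonneg θ₂
  unfold charBound
  linarith

theorem abs_trig_le (a b d x : ℝ) :
    |a * Real.cos x + b * Real.sin x + d| ≤ |a| + |b| + |d| := by
  refine (abs_add_three _ _ _).trans ?_
  rw [abs_mul, abs_mul]
  have h1 := mul_le_of_le_one_right (abs_nonneg a) (Real.abs_cos_le_one x)
  have h2 := mul_le_of_le_one_right (abs_nonneg b) (Real.abs_sin_le_one x)
  linarith

theorem abs_charLHS_sub_le (hβ : 1 ≤ β) :
    |charLHS θ₁ θ₂ β - β ^ 3 * Real.sin β| ≤ charBound θ₁ θ₂ * β ^ 2 := by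
  have h := abs_trig_le ((θ₁ + θ₂) * β ^ 2 - 2 * θ₂) (-(θ₁ + 2 * θ₂) * β) (2 * θ₂) β
  have e : charLHS θ₁ θ₂ β - β ^ 3 * Real.sin β = ((θ₁ + θ₂) * β ^ 2 - 2 * θ₂) * Real.cos β
      + (-(θ₁ + 2 * θ₂) * β) * Real.sin β + 2 * θ₂ := by
    simp only [charLHS]; ring
  rw [e]
  refine h.trans ?_
  have hb : β ≤ β ^ 2 := by nlinarith
  have hb1 : 1 ≤ β ^ 2 := by nlinarith
  have n1 := abs_nonneg θ₁
  have n2 := abs_nonneg θ₂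
  have h1 : |(θ₁ + θ₂) * β ^ 2 - 2 * θ₂| ≤ (|θ₁| + |θ₂|) * β ^ 2 + 2 * |θ₂| := by
    refine (abs_sub _ _).trans ?_
    rw [abs_mul, abs_mul, abs_of_nonneg (sq_nonneg β), abs_two]
    gcongr
    exact abs_add_le _ _
  have h2 : |-(θ₁ + 2 * θ₂) * β| ≤ (|θ₁| + 2 * |θ₂|) * β := by
    rw [abs_mul, abs_neg, abs_of_nonneg (by linarith : (0 : ℝ) ≤ β)]
    gcongr
    refine (abs_add_le _ _).trans ?_
    rw [abs_mul, abs_two]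
  have h3 : |2 * θ₂| = 2 * |θ₂| := by rw [abs_mul, abs_two]
  rw [h3]
  unfold charBound
  nlinarith [mul_le_mul_of_nonneg_left hb n1, mul_le_mul_of_nonneg_left hb n2,
    mul_le_mul_of_nonneg_left hb1 n2, mul_le_mul_of_nonneg_left hb1 n1]

theorem abs_charDeriv_sub_le (hβ : 1 ≤ β) :
    |charDeriv θ₁ θ₂ β - β ^ 3 * Real.cos β| ≤ charBound θ₁ θ₂ * β ^ 2 := by
  have h := abs_trig_le (θ₁ * β)
    (3 * β ^ 2 - (θ₁ + 2 * θ₂) - ((θ₁ + θ₂) * β ^ 2 - 2 * θ₂)) 0 β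
  have e : charDeriv θ₁ θ₂ β - β ^ 3 * Real.cos β = (θ₁ * β) * Real.cos β
      + (3 * β ^ 2 - (θ₁ + 2 * θ₂) - ((θ₁ + θ₂) * β ^ 2 - 2 * θ₂)) * Real.sin β + 0 := by
    simp only [charDeriv]; ring
  rw [e]
  refine h.trans ?_
  have hb : β ≤ β ^ 2 := by nlinarith
  have hb1 : 1 ≤ β ^ 2 := by nlinarith
  have n1 := abs_nonneg θ₁
  have n2 := abs_nonneg θ₂
  have h1 : |θ₁ * β| = |θ₁| * β := by
    rw [abs_mul, abs_of_nonneg (by linarith : (0 : ℝ) ≤ β)]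
  have h2 : |3 * β ^ 2 - (θ₁ + 2 * θ₂) - ((θ₁ + θ₂) * β ^ 2 - 2 * θ₂)|
      ≤ 3 * β ^ 2 + |θ₁| + (|θ₁| + |θ₂|) * β ^ 2 := by
    have e2 : 3 * β ^ 2 - (θ₁ + 2 * θ₂) - ((θ₁ + θ₂) * β ^ 2 - 2 * θ₂)
      = 3 * β ^ 2 - θ₁ - (θ₁ + θ₂) * β ^ 2 := by ring
    rw [e2]
    refine (abs_sub _ _).trans ?_
    rw [abs_mul (θ₁ + θ₂), abs_of_nonneg (sq_nonneg β)]
    gcongr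
    · refine (abs_sub _ _).trans ?_
      rw [abs_of_nonneg (by positivity : (0 : ℝ) ≤ 3 * β ^ 2)]
    · exact abs_add_le _ _
  rw [h1, abs_zero]
  unfold charBound
  nlinarith [mul_le_mul_of_nonneg_left hb n1, mul_le_mul_of_nonneg_left hb1 n1]

theorem abs_le_of_cube_mul {C u : ℝ} (hβ : 4 * C ≤ β) (hβ0 : 0 < β)
    (h : |0 - β ^ 3 * u| ≤ C * β ^ 2) : |u| ≤ 1 / 4 := by
  rw [zero_sub, abs_neg, abs_mul, abs_of_pos (by positivity)] at h
  have h2 : 0 < β ^ 2 := by positivity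
  have h3 : β * |u| ≤ C := by
    by_contra! hlt
    nlinarith [mul_lt_mul_of_pos_right hlt h2]
  by_contra! hlt
  nlinarith

/-- Large roots of the characteristic equation are separated. -/
theorem roots_separated (hβ : 4 * charBound θ₁ θ₂ ≤ β) (hlt : β < γ)
    (hβr : charLHS θ₁ θ₂ β = 0) (hγr : charLHS θ₁ θ₂ γ = 0) : 1 / 2 ≤ γ - β := by
  by_contra! hd
  have hC := three_le_charBound θ₁ θ₂
  obtain ⟨ξ, hξ, hξ0⟩ := exists_hasDerivAt_eq_zero hlt
    (fun x _ => (hasDerivAt_charLHS θ₁ θ₂ x).continuousAt.continuousWithinAt)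
    (hβr.trans hγr.symm) (fun x _ => hasDerivAt_charLHS θ₁ θ₂ x)
  have h1 := abs_charLHS_sub_le (θ₁ := θ₁) (θ₂ := θ₂) (β := β) (by linarith)
  have h2 := abs_charDeriv_sub_le (θ₁ := θ₁) (θ₂ := θ₂) (β := ξ) (by linarith [hξ.1])
  rw [hβr] at h1
  rw [hξ0] at h2
  have hs := abs_le_of_cube_mul hβ (by linarith) h1
  have hc := abs_le_of_cube_mul (hβ.trans hξ.1.le) (by linarith [hξ.1]) h2
  have hss : |Real.sin ξ - Real.sin β| ≤ 1 / 2 := by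
    have := Real.abs_sin_sub_sin_le ξ β
    rw [abs_of_pos (by linarith [hξ.1] : 0 < ξ - β)] at this
    linarith [hξ.2]
  have hsξ : |Real.sin ξ| ≤ 3 / 4 := by
    have := abs_add_le (Real.sin ξ - Real.sin β) (Real.sin β)
    rw [sub_add_cancel] at this
    linarith
  have := Real.sin_sq_add_cos_sq ξ
  have e1 : Real.sin ξ ^ 2 ≤ (3 / 4) ^ 2 := sq_le_sq' (abs_le.1 hsξ).1 (abs_le.1 hsξ).2
  have e2 : Real.cos ξ ^ 2 ≤ (1 / 4) ^ 2 := sq_le_sq' (abs_le.1 hc).1 (abs_le.1 hc).2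
  norm_num at e1 e2
  linarith

theorem analyticOnNhd_charLHS (θ₁ θ₂ : ℝ) : AnalyticOnNhd ℝ (charLHS θ₁ θ₂) univ := by
  intro x _
  unfold charLHS
  fun_prop

theorem exists_charLHS_ne_zero (θ₁ θ₂ : ℝ) : ∃ x, charLHS θ₁ θ₂ x ≠ 0 := by
  by_contra! h
  -- If every point were a root, two large roots at distance `1/4` would exist.
  have := roots_separated (γ := 4 * charBound θ₁ θ₂ + 1 / 4) le_rfl (by linarith) (h _) (h _)
  linarith

theorem finite_roots_Icc (θ₁ θ₂ R : ℝ) : {β | β ∈ Icc 0 R ∧ charLHS θ₁ θ₂ β = 0}.Finite := by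
  by_contra hinf
  obtain ⟨x, _, hx⟩ := (show Set.Infinite _ from hinf).exists_accPt_of_subset_isCompact
    (isCompact_Icc (a := (0 : ℝ)) (b := R)) fun β hβ => hβ.1
  have hfr : ∃ᶠ β in 𝓝[≠] x, charLHS θ₁ θ₂ β = 0 :=
    (accPt_iff_frequently_nhdsNE.1 hx).mono fun β hβ => hβ.2
  obtain ⟨y, hy⟩ := exists_charLHS_ne_zero θ₁ θ₂
  exact hy ((analyticOnNhd_charLHS θ₁ θ₂).eqOn_zero_of_preconnected_of_frequently_eq_zero
    isPreconnected_univ (mem_univ x) hfr (mem_univ y))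

theorem summable_roots_inv_sq (θ₁ θ₂ : ℝ) :
    Summable fun β : {β : ℝ | 0 < β ∧ charLHS θ₁ θ₂ β = 0} => ((β : ℝ) ^ 2)⁻¹ := by
  set R := 4 * charBound θ₁ θ₂ with hR
  have hC := three_le_charBound θ₁ θ₂
  set S := {β : ℝ | 0 < β ∧ charLHS θ₁ θ₂ β = 0}
  have hfin : {β : S | (β : ℝ) < R}.Finite := by
    refine Set.Finite.of_finite_image (f := ((↑) : S → ℝ)) ?_ Subtype.val_injective.injOn
    refine (finite_roots_Icc θ₁ θ₂ R).subset ?_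
    rintro _ ⟨β, hβ, rfl⟩
    exact ⟨⟨β.2.1.le, le_of_lt hβ⟩, β.2.2⟩
  rw [← hfin.summable_compl_iff]
  -- Roots at least `1/2` apart have distinct values of `⌊2β⌋`, so the series is dominated by `∑
  -- 4/n²`.
  have hinj : Function.Injective
      fun β : ({β : S | (β : ℝ) < R}ᶜ : Set S) => ⌊2 * ((β : S) : ℝ)⌋₊ := by
    have aux : ∀ β γ : ({β : S | (β : ℝ) < R}ᶜ : Set S), ((β : S) : ℝ) < γ →
        ⌊2 * ((β : S) : ℝ)⌋₊ ≠ ⌊2 * ((γ : S) : ℝ)⌋₊ := by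
      intro β γ hlt heq
      have h1 := roots_separated (not_lt.1 β.2) hlt β.1.2.2 γ.1.2.2
      have h2 := Nat.lt_floor_add_one (2 * ((β : S) : ℝ))
      have h3 : (⌊2 * ((γ : S) : ℝ)⌋₊ : ℝ) ≤ 2 * γ :=
        Nat.floor_le (by linarith [γ.1.2.1])
      have h4 := Nat.floor_le (a := 2 * ((β : S) : ℝ)) (by linarith [β.1.2.1])
      have h5 : ⌊2 * ((β : S) : ℝ)⌋₊ + 1 ≤ ⌊2 * ((γ : S) : ℝ)⌋₊ :=
        Nat.le_floor (by push_cast; linarith)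
      omega
    intro β γ h
    by_contra hne
    rcases lt_trichotomy ((β : S) : ℝ) γ with hlt | heq | hlt
    · exact aux β γ hlt h
    · exact hne (Subtype.ext (Subtype.ext heq))
    · exact aux γ β hlt h.symm
  have hsum : Summable fun n : ℕ => 4 * ((n : ℝ) ^ 2)⁻¹ :=
    (Real.summable_nat_pow_inv.2 one_lt_two).mul_left 4
  refine Summable.of_nonneg_of_le (fun _ => inv_nonneg.2 (sq_nonneg _)) (fun β => ?_)
    (hsum.comp_injective hinj)
  have hβ : R ≤ ((β : S) : ℝ) := not_lt.1 β.2
  have h4 := Nat.floor_le (a := 2 * ((β : S) : ℝ)) (by linarith [β.1.2.1])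
  have h5 : 1 ≤ ⌊2 * ((β : S) : ℝ)⌋₊ := Nat.le_floor (by push_cast; linarith)
  have h6 : (1 : ℝ) ≤ ⌊2 * ((β : S) : ℝ)⌋₊ := by exact_mod_cast h5
  have hb0 : 0 < ((β : S) : ℝ) := β.1.2.1
  simp only [Function.comp]
  rw [← div_eq_mul_inv, inv_eq_one_div, div_le_div_iff₀ (pow_pos hb0 2) (pow_pos (by linarith) 2)]
  nlinarith

/-- The antiderivative is `-k cos/β + k' sin/β² + k'' cos/β³`, with argument `βξ`, since `k` is
quadratic. -/
theorem integral_kernel_mul_sin (hβ : 0 < β) (hr : charLHS θ₁ θ₂ β = 0) :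
    ∫ ξ in (0 : ℝ)..1, kernel θ₁ θ₂ ξ * Real.sin (β * ξ) = Real.sin β := by
  have hne := hβ.ne'
  have hd : ∀ ξ ∈ uIcc (0 : ℝ) 1, HasDerivAt (fun ξ => -(kernel θ₁ θ₂ ξ / β) * Real.cos (β * ξ)
      + ((θ₁ + 2 * θ₂ * ξ) / β ^ 2) * Real.sin (β * ξ) + (2 * θ₂ / β ^ 3) * Real.cos (β * ξ))
      (kernel θ₁ θ₂ ξ * Real.sin (β * ξ)) ξ := by
    intro ξ _
    have hk : HasDerivAt (kernel θ₁ θ₂) (θ₁ + 2 * θ₂ * ξ) ξ := by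
      refine (((hasDerivAt_id ξ).const_mul θ₁).add
        ((hasDerivAt_pow 2 ξ).const_mul θ₂)).congr_deriv ?_
      simp
      ring
    have hl : HasDerivAt (fun ξ => θ₁ + 2 * θ₂ * ξ) (2 * θ₂) ξ := by
      simpa using ((hasDerivAt_id ξ).const_mul (2 * θ₂)).const_add θ₁
    have hm : HasDerivAt (fun ξ => β * ξ) β ξ := by simpa using (hasDerivAt_id ξ).const_mul β
    have hs := hm.sin
    have hc := hm.cos
    refine ((((hk.div_const β).neg.mul hc).add ((hl.div_const (β ^ 2)).mul hs)).add
      (hc.const_mul (2 * θ₂ / β ^ 3))).congr_deriv ?_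
    simp only [Pi.neg_apply]
    field_simp
    ring
  rw [intervalIntegral.integral_eq_sub_of_hasDerivAt hd
    (Continuous.intervalIntegrable (by unfold kernel; fun_prop) _ _)]
  simp only [charLHS] at hr
  simp only [kernel, mul_one, mul_zero, Real.cos_zero, Real.sin_zero]
  field_simp
  linarith

end Roots

/-! ### Unconditionally convergent series with bounded multipliers -/

theorem exists_bound_sum {ι E : Type*} [NormedAddCommGroup E] [CompleteSpace E] {v : ι → E}
    (hv : Summable v) : ∃ C, ∀ F : Finset ι, ‖∑ i ∈ F, v i‖ ≤ C := by
  classical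
  obtain ⟨s, hs⟩ := summable_iff_vanishing_norm.1 hv 1 one_pos
  refine ⟨(∑ i ∈ s, ‖v i‖) + 1, fun F => ?_⟩
  rw [← Finset.sum_inter_add_sum_sdiff F s]
  refine (norm_add_le _ _).trans (add_le_add ?_ (hs _ Finset.sdiff_disjoint).le)
  exact (norm_sum_le _ _).trans
    (Finset.sum_le_sum_of_subset_of_nonneg Finset.inter_subset_right fun _ _ _ => norm_nonneg _)

section Multipliers

variable {ι E : Type*} [NormedAddCommGroup E] [NormedSpace ℝ E]

/-- A weight in `[0,1]` makes the sum a convex combination of the sums with and without that term.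
The shift `a` carries the terms already decided through the induction. -/
theorem norm_add_sum_smul_le [DecidableEq ι] {v : ι → E} {w : ι → ℝ}
    (hw : ∀ i, w i ∈ Icc (0 : ℝ) 1) {C : ℝ} (F : Finset ι) :
    ∀ a : E, (∀ G ⊆ F, ‖a + ∑ i ∈ G, v i‖ ≤ C) → ‖a + ∑ i ∈ F, w i • v i‖ ≤ C := by
  induction F using Finset.induction_on with
  | empty => intro a h; simpa using h ∅ le_rfl
  | insert i F hi ih =>
    intro a h
    have h1 : ‖a + ∑ j ∈ F, w j • v j‖ ≤ C :=
      ih a fun G hG => h G (hG.trans (Finset.subset_insert _ _))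
    have h2 : ‖(a + v i) + ∑ j ∈ F, w j • v j‖ ≤ C := by
      refine ih (a + v i) fun G hG => ?_
      have := h (insert i G) (Finset.insert_subset_insert i hG)
      rwa [Finset.sum_insert (fun hc => hi (hG hc)), ← add_assoc] at this
    rw [Finset.sum_insert hi]
    have e : a + (w i • v i + ∑ j ∈ F, w j • v j)
        = (1 - w i) • (a + ∑ j ∈ F, w j • v j) + w i • ((a + v i) + ∑ j ∈ F, w j • v j) := by
      module
    have h0 := (hw i).1
    have h3 : 0 ≤ 1 - w i := sub_nonneg.2 (hw i).2
    rw [e]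
    refine (norm_add_le _ _).trans ?_
    rw [norm_smul, norm_smul, Real.norm_of_nonneg h0, Real.norm_of_nonneg h3]
    nlinarith [mul_le_mul_of_nonneg_left h1 h3, mul_le_mul_of_nonneg_left h2 h0]

/-- Multipliers in `[0,1]` do not increase the bound of the partial sums. -/
theorem norm_sum_smul_le {v : ι → E} {w : ι → ℝ} (hw : ∀ i, w i ∈ Icc (0 : ℝ) 1) {C : ℝ}
    (F : Finset ι) (h : ∀ G ⊆ F, ‖∑ i ∈ G, v i‖ ≤ C) : ‖∑ i ∈ F, w i • v i‖ ≤ C := by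
  classical
  simpa using norm_add_sum_smul_le hw F (0 : E) (v := v) (C := C) (by simpa using h)

variable [CompleteSpace E]

/-- The weights `1 - w` also lie in `[0,1]`, so the tail of `∑ (1 - w) v` is small uniformly in `t`;
the finite head tends to `0` termwise. -/
theorem tendsto_of_hasSum_smul {v : ι → E} {a : E} (hv : HasSum v a) {T : Type*} {l : Filter T}
    {w : T → ι → ℝ} (hw : ∀ᶠ t in l, ∀ i, w t i ∈ Icc (0 : ℝ) 1)
    (hw1 : ∀ i, Tendsto (fun t => w t i) l (𝓝 1)) {S : T → E}
    (hS : ∀ᶠ t in l, HasSum (fun i => w t i • v i) (S t)) : Tendsto S l (𝓝 a) := by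
  classical
  rw [Metric.tendsto_nhds]
  intro ε hε
  obtain ⟨s, hs⟩ := summable_iff_vanishing_norm.1 hv.summable (ε / 3) (by linarith)
  have hfin : Tendsto (fun t => ∑ i ∈ s, (1 - w t i) * ‖v i‖) l (𝓝 0) := by
    have := tendsto_finsetSum s fun i _ => ((hw1 i).const_sub 1).mul_const ‖v i‖
    simpa using this
  filter_upwards [hw, hS, hfin.eventually_lt_const (show 0 < ε / 3 by linarith)] with t ht hSt hft
  have hd : HasSum (fun i => (1 - w t i) • v i) (a - S t) := by
    simpa [sub_smul] using hv.sub hSt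
  rw [dist_comm, dist_eq_norm]
  refine lt_of_le_of_lt (le_of_tendsto hd.norm (b := 2 * ε / 3) ?_) (by linarith)
  filter_upwards [eventually_ge_atTop s] with F hF
  rw [← Finset.sum_sdiff hF]
  refine (norm_add_le _ _).trans ?_
  have h1 : ‖∑ i ∈ F \ s, (1 - w t i) • v i‖ ≤ ε / 3 :=
    norm_sum_smul_le (fun i => ⟨sub_nonneg.2 (ht i).2, sub_le_self _ (ht i).1⟩) _
      fun G hG => (hs G (Finset.sdiff_disjoint.mono_left hG)).le
  have h2 : ‖∑ i ∈ s, (1 - w t i) • v i‖ ≤ ∑ i ∈ s, (1 - w t i) * ‖v i‖ := by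
    refine (norm_sum_le _ _).trans (le_of_eq (Finset.sum_congr rfl fun i _ => ?_))
    rw [norm_smul, Real.norm_of_nonneg (sub_nonneg.2 (ht i).2)]
  linarith

/-- Terms of an unconditionally convergent series along the same vector can be collected. -/
theorem exists_hasSum_injOn_support {X : Type*} {e : X → E} {α : ℕ → X} {Y : ℕ → ℝ} {a : E}
    (he : ∀ n, e (α n) ≠ 0) (h : HasSum (fun n => Y n • e (α n)) a) :
    ∃ Y' : ℕ → ℝ, HasSum (fun n => Y' n • e (α n)) a ∧ InjOn α (Function.support Y') := by
  classical
  have hex : ∀ n, ∃ m, α m = α n := fun n => ⟨n, rfl⟩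
  -- The first index with the same frequency represents the class and receives the sum of its
  -- coefficients.
  let N : ℕ → ℕ := fun n => Nat.find (hex n)
  have hN : ∀ n, α (N n) = α n := fun n => Nat.find_spec (hex n)
  have hNN : ∀ m n, α m = α n → N m = N n := fun m n hmn => by
    simp only [N, hmn]
  have hfib : ∀ m, HasSum (fun n : {n // N n = m} => Y n • e (α n))
      ((∑' n : {n // N n = m}, Y n) • e (α m)) := by
    intro m
    have h1 : ∀ n : {n // N n = m}, Y n • e (α n) = Y n • e (α m) := fun n => by
      rw [← hN n, n.2]
    have h2 := h.summable.comp_injective (Subtype.val_injective (p := fun n => N n = m))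
    have h3 : Summable fun n : {n // N n = m} => Y n • e (α m) := h2.congr h1
    simp only [h1]
    -- A norming functional turns summability of the multiples of one vector into summability of the
    -- coefficients.
    obtain ⟨φ, -, hφ⟩ := exists_dual_vector ℝ (e (α m)) (norm_ne_zero_iff.2 (he m))
    have h4 : Summable fun n : {n // N n = m} => Y n := by
      refine (summable_mul_right_iff (norm_ne_zero_iff.2 (he m))).1 ((h3.mapL φ).congr fun n => ?_)
      simp [hφ]
    exact h4.hasSum.smul_const _
  refine ⟨fun m => ∑' n : {n // N n = m}, Y n, ?_, ?_⟩
  · have h4 := (Equiv.sigmaFiberEquiv N).hasSum_iff.2 h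
    exact h4.sigma hfib
  · have hs : ∀ m, (∑' n : {n // N n = m}, Y n) ≠ 0 → N m = m := by
      intro m hm
      by_contra hne
      refine hm ?_
      have : IsEmpty {n // N n = m} := ⟨fun n => hne (by
        have := hNN m n (by rw [← hN n, n.2])
        rw [this, n.2])⟩
      exact tsum_empty
    intro m hm n hn hmn
    rw [← hs m hm, ← hs n hn, hNN m n hmn]

end Multipliers

/-! ### Sine expansions as series in `L²` -/

theorem memLp_sin (β : ℝ) : MemLp (fun x => Real.sin (β * x)) 2 unitMeasure :=
  memLp_of_continuousOn (by fun_prop)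

/-- The function `sin(β x)` as an element of `L²(0,1)`. -/
def sineLp (β : ℝ) : Lp ℝ 2 unitMeasure := (memLp_sin β).toLp _

theorem memLp_sineSum (α Y : ℕ → ℝ) (F : Finset ℕ) :
    MemLp (fun x => ∑ n ∈ F, Y n * Real.sin (α n * x)) 2 unitMeasure :=
  memLp_of_continuousOn (by fun_prop)

theorem sum_smul_sineLp (α Y : ℕ → ℝ) (F : Finset ℕ) :
    ∑ n ∈ F, Y n • sineLp (α n) = (memLp_sineSum α Y F).toLp _ := by
  classical
  induction F using Finset.induction_on with
  | empty =>
    symm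
    simp
  | insert n F hn ih =>
    rw [Finset.sum_insert hn, ih, sineLp, ← MemLp.toLp_const_smul, ← MemLp.toLp_add]
    congr 1
    ext x
    simp [Finset.sum_insert hn]

theorem hasSineExpansion_iff {α Y : ℕ → ℝ} {f : ℝ → ℝ} (hf : MemLp f 2 unitMeasure) :
    HasSineExpansion α Y f ↔ HasSum (fun n => Y n • sineLp (α n)) (hf.toLp f) := by
  rw [HasSum, SummationFilter.unconditional_filter, tendsto_iff_edist_tendsto_0, HasSineExpansion]
  refine tendsto_congr fun F => ?_
  rw [sum_smul_sineLp, edist_comm, Lp.edist_toLp_toLp]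
  rfl

theorem norm_toLp_sq {f : ℝ → ℝ} (hf : MemLp f 2 unitMeasure) :
    ‖hf.toLp f‖ ^ 2 = ∫ x in (0 : ℝ)..1, f x ^ 2 := by
  rw [Lp.norm_toLp]
  exact toReal_normL2_sq hf

theorem norm_sineLp_sq {β : ℝ} (hβ : 0 < β) :
    ‖sineLp β‖ ^ 2 = 1 / 2 - Real.sin (2 * β) / (4 * β) := by
  rw [sineLp, norm_toLp_sq, intervalIntegral.integral_comp_mul_left (fun x => Real.sin x ^ 2) hβ.ne',
    integral_sin_sq, Real.sin_two_mul]
  simp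
  field_simp
  ring

theorem norm_sineLp_sq_pos {β : ℝ} (hβ : 0 < β) : 0 < 1 / 2 - Real.sin (2 * β) / (4 * β) := by
  have := Real.sin_lt (show 0 < 2 * β by linarith)
  rw [sub_pos, div_lt_div_iff₀ (by linarith) two_pos]
  linarith

theorem sineLp_ne_zero {β : ℝ} (hβ : 0 < β) : sineLp β ≠ 0 := by
  intro h
  have h1 := norm_sineLp_sq hβ
  have h2 := norm_sineLp_sq_pos hβ
  simp only [h, norm_zero] at h1
  linarith

/-- The squared norm is positive and continuous on the compact range up to `max β₀ 1`, and at least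
`1/4` for `β ≥ 1`. -/
theorem exists_le_norm_sineLp {β₀ : ℝ} (hβ₀ : 0 < β₀) :
    ∃ m, 0 < m ∧ ∀ β, β₀ ≤ β → m ≤ ‖sineLp β‖ := by
  have hne : (Icc β₀ (max β₀ 1)).Nonempty := ⟨β₀, le_rfl, le_max_left _ _⟩
  obtain ⟨β₁, hβ₁, hmin⟩ := isCompact_Icc.exists_isMinOn hne
    (f := fun β : ℝ => 1 / 2 - Real.sin (2 * β) / (4 * β))
    (ContinuousOn.sub continuousOn_const (ContinuousOn.div (by fun_prop) (by fun_prop)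
      fun β hβ => by have := hβ₀.trans_le hβ.1; positivity))
  have hpos := norm_sineLp_sq_pos (hβ₀.trans_le hβ₁.1)
  set d := 1 / 2 - Real.sin (2 * β₁) / (4 * β₁)
  refine ⟨Real.sqrt (min d (1 / 4)), Real.sqrt_pos.2 (lt_min hpos (by norm_num)), fun β hβ => ?_⟩
  have hβ0 := hβ₀.trans_le hβ
  refine Real.sqrt_le_iff.2 ⟨norm_nonneg _, ?_⟩
  rw [norm_sineLp_sq hβ0]
  rcases le_total β (max β₀ 1) with h | h
  · exact (min_le_left _ _).trans (hmin ⟨hβ, h⟩)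
  · refine (min_le_right _ _).trans ?_
    have h1 : 1 ≤ β := (le_max_right _ _).trans h
    have h2 : Real.sin (2 * β) / (4 * β) ≤ 1 / 4 := by
      rw [div_le_div_iff₀ (by linarith) (by norm_num)]
      nlinarith [Real.sin_le_one (2 * β)]
    linarith

theorem exists_bound_coeff {α Y : ℕ → ℝ} {β₀ : ℝ} (hβ₀ : 0 < β₀) (hα : ∀ n, β₀ ≤ α n)
    (h : Summable fun n => Y n • sineLp (α n)) : ∃ B, ∀ n, |Y n| ≤ B := by
  obtain ⟨C, hC⟩ := exists_bound_sum h
  obtain ⟨m, hm, hle⟩ := exists_le_norm_sineLp hβ₀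
  refine ⟨C / m, fun n => ?_⟩
  have h1 := hC {n}
  rw [Finset.sum_singleton, norm_smul, Real.norm_eq_abs] at h1
  rw [le_div_iff₀ hm]
  exact (mul_le_mul_of_nonneg_left (hle _ (hα n)) (abs_nonneg _)).trans h1

/-! ### The series solution -/

/-- From `1 + u + u²/2 ≤ eᵘ` at `u = β²δ`. Hence `(1 + β²) e^{-β²δ}` is at most a constant times
`β⁻²`. -/
theorem sq_add_pow_four_le_exp {δ : ℝ} (hδ : 0 < δ) (β : ℝ) :
    β ^ 2 * (1 + β ^ 2) ≤ (1 / δ + 2 / δ ^ 2) * Real.exp (β ^ 2 * δ) := by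
  have h := Real.quadratic_le_exp_of_nonneg (show 0 ≤ β ^ 2 * δ by positivity)
  have h0 : 0 ≤ β ^ 2 := sq_nonneg β
  have e1 : β ^ 2 ≤ 1 / δ * Real.exp (β ^ 2 * δ) := by
    rw [one_div, ← div_eq_inv_mul, le_div_iff₀ hδ]
    nlinarith [sq_nonneg (β ^ 2 * δ)]
  have e2 : β ^ 2 * β ^ 2 ≤ 2 / δ ^ 2 * Real.exp (β ^ 2 * δ) := by
    rw [div_mul_eq_mul_div, le_div_iff₀ (by positivity)]
    nlinarith [mul_nonneg h0 hδ.le]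
  linarith

/-- Coefficients and frequencies of a series solution of the closed-loop system. -/
structure ModalData (c θ₁ θ₂ : ℝ) (α Y : ℕ → ℝ) : Prop where
  pos : ∀ n, 0 < α n
  root : ∀ n, charLHS θ₁ θ₂ (α n) = 0
  exponent_nonpos : ∀ n, c - α n ^ 2 ≤ 0
  bounded : ∃ B, ∀ n, |Y n| ≤ B
  injOn : InjOn α (Function.support Y)

/-- The amplitude of a mode at time `t`. -/
def amplitude (c : ℝ) (α Y : ℕ → ℝ) (n : ℕ) (t : ℝ) : ℝ := Y n * Real.exp ((c - α n ^ 2) * t)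

/-- A bound for the amplitude and its first two spatial derivatives after time `δ`. -/
def modeBound (c : ℝ) (α Y : ℕ → ℝ) (δ : ℝ) (n : ℕ) : ℝ :=
  |amplitude c α Y n δ| * (1 + α n ^ 2)

/-- The sum of the modes. -/
def modalSum (c : ℝ) (α Y : ℕ → ℝ) (x t : ℝ) : ℝ :=
  ∑' n, amplitude c α Y n t * Real.sin (α n * x)

namespace ModalData

variable {c θ₁ θ₂ : ℝ} {α Y : ℕ → ℝ} {t x δ : ℝ}

/-- On the support of `Y` the frequencies are distinct roots, so a multiple of `∑ β⁻²` over the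
roots dominates. -/
theorem summable_modeBound (h : ModalData c θ₁ θ₂ α Y) (hδ : 0 < δ) :
    Summable (modeBound c α Y δ) := by
  obtain ⟨B, hB⟩ := h.bounded
  have hB0 : 0 ≤ B := (abs_nonneg _).trans (hB 0)
  set S := Function.support Y
  have hzero : ∀ n ∉ range ((↑) : S → ℕ), modeBound c α Y δ n = 0 := by
    intro n hn
    have : Y n = 0 := by simpa [S] using hn
    simp [modeBound, amplitude, this]
  rw [← (Subtype.val_injective (p := (· ∈ S))).summable_iff hzero]
  let g : S → {β : ℝ | 0 < β ∧ charLHS θ₁ θ₂ β = 0} := fun n => ⟨α n, h.pos n, h.root n⟩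
  have hg : Function.Injective g := fun m n hmn =>
    Subtype.ext (h.injOn m.2 n.2 (congrArg Subtype.val hmn))
  have hsum := ((summable_roots_inv_sq θ₁ θ₂).comp_injective hg).mul_left
    (B * (Real.exp (c * δ) * (1 / δ + 2 / δ ^ 2)))
  refine Summable.of_nonneg_of_le (fun n => ?_) (fun n => ?_) hsum
  · simp only [Function.comp, modeBound]
    positivity
  · have hα := h.pos n
    have hexp := sq_add_pow_four_le_exp hδ (α n)
    simp only [Function.comp, modeBound, amplitude, g]
    rw [abs_mul, abs_of_pos (Real.exp_pos _), mul_assoc, mul_assoc]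
    refine mul_le_mul (hB n) ?_ (by positivity) hB0
    rw [sub_mul, Real.exp_sub, div_mul_eq_mul_div, mul_assoc, mul_div_assoc]
    refine mul_le_mul_of_nonneg_left ?_ (Real.exp_pos _).le
    rw [← div_eq_mul_inv, div_le_div_iff₀ (Real.exp_pos _) (by positivity)]
    linarith

theorem abs_amplitude_le (h : ModalData c θ₁ θ₂ α Y) (ht : δ ≤ t) (n : ℕ) :
    |amplitude c α Y n t| ≤ |amplitude c α Y n δ| := by
  simp only [amplitude, abs_mul, Real.abs_exp]
  refine mul_le_mul_of_nonneg_left (Real.exp_le_exp.2 ?_) (abs_nonneg _)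
  exact mul_le_mul_of_nonpos_left ht (h.exponent_nonpos n)

theorem norm_amplitude_mul_le (h : ModalData c θ₁ θ₂ α Y) (ht : δ ≤ t) (n : ℕ) {u : ℝ}
    (hu : |u| ≤ 1 + α n ^ 2) : ‖amplitude c α Y n t * u‖ ≤ modeBound c α Y δ n := by
  rw [Real.norm_eq_abs, abs_mul]
  exact mul_le_mul (h.abs_amplitude_le ht n) hu (abs_nonneg _) (abs_nonneg _)

theorem abs_le_one_add_sq {u : ℝ} (a : ℝ) (hu : |u| ≤ 1) : |u| ≤ 1 + a ^ 2 := by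
  linarith [sq_nonneg a]

theorem abs_mul_le_one_add_sq {u : ℝ} (a : ℝ) (hu : |u| ≤ 1) : |a * u| ≤ 1 + a ^ 2 := by
  rw [abs_mul]
  have h1 := mul_le_of_le_one_right (abs_nonneg a) hu
  nlinarith [sq_nonneg (|a| - 1), sq_abs a]

theorem abs_sq_mul_le_one_add_sq {u : ℝ} (a : ℝ) (hu : |u| ≤ 1) : |-a ^ 2 * u| ≤ 1 + a ^ 2 := by
  rw [abs_mul, abs_neg, abs_of_nonneg (sq_nonneg a)]
  have h1 := mul_le_of_le_one_right (sq_nonneg a) hu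
  linarith

theorem summable_amplitude_mul (h : ModalData c θ₁ θ₂ α Y) (ht : 0 < t) {u : ℕ → ℝ}
    (hu : ∀ n, |u n| ≤ 1 + α n ^ 2) : Summable fun n => amplitude c α Y n t * u n :=
  Summable.of_norm_bounded (h.summable_modeBound ht) fun n =>
    h.norm_amplitude_mul_le le_rfl n (hu n)

theorem hasSum_modalSum (h : ModalData c θ₁ θ₂ α Y) (ht : 0 < t) (x : ℝ) :
    HasSum (fun n => amplitude c α Y n t * Real.sin (α n * x)) (modalSum c α Y x t) :=
  (h.summable_amplitude_mul ht fun _ => abs_le_one_add_sq _ (Real.abs_sin_le_one _)).hasSum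

theorem continuousOn_tsum_amplitude (h : ModalData c θ₁ θ₂ α Y) {u : ℕ → ℝ → ℝ}
    (huc : ∀ n, Continuous (u n)) (hu : ∀ n x, |u n x| ≤ 1 + α n ^ 2) :
    ContinuousOn (fun p : ℝ × ℝ => ∑' n, amplitude c α Y n p.2 * u n p.1) (univ ×ˢ Ioi 0) := by
  intro p hp
  have hp2 : 0 < p.2 := hp.2
  have hc : ContinuousOn (fun p : ℝ × ℝ => ∑' n, amplitude c α Y n p.2 * u n p.1)
      (univ ×ˢ Ioi (p.2 / 2)) := by
    refine continuousOn_tsum (fun n => ?_) (h.summable_modeBound (half_pos hp2))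
      fun n q hq => h.norm_amplitude_mul_le (le_of_lt hq.2) n (hu n q.1)
    have := huc n
    simp only [amplitude]
    fun_prop
  exact (hc.continuousAt ((isOpen_univ.prod isOpen_Ioi).mem_nhds
    ⟨mem_univ _, half_lt_self hp2⟩)).continuousWithinAt

theorem hasDerivAt_modalSum (h : ModalData c θ₁ θ₂ α Y) (ht : 0 < t) (x : ℝ) :
    HasDerivAt (fun x => modalSum c α Y x t)
      (∑' n, amplitude c α Y n t * (α n * Real.cos (α n * x))) x := by
  refine hasDerivAt_tsum (h.summable_modeBound ht) (fun n y => ?_)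
    (fun n y => h.norm_amplitude_mul_le le_rfl n (abs_mul_le_one_add_sq _ (Real.abs_cos_le_one _)))
    (y₀ := 0) (by simp) x
  have := (((hasDerivAt_id y).const_mul (α n)).sin).const_mul (amplitude c α Y n t)
  refine this.congr_deriv ?_
  simp [mul_comm]

theorem hasDerivAt_modalSum_x (h : ModalData c θ₁ θ₂ α Y) (ht : 0 < t) (x : ℝ) :
    HasDerivAt (fun x => ∑' n, amplitude c α Y n t * (α n * Real.cos (α n * x)))
      (∑' n, amplitude c α Y n t * (-α n ^ 2 * Real.sin (α n * x))) x := by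
  refine hasDerivAt_tsum (h.summable_modeBound ht) (fun n y => ?_)
    (fun n y => h.norm_amplitude_mul_le le_rfl n
      (abs_sq_mul_le_one_add_sq _ (Real.abs_sin_le_one _)))
    (h.summable_amplitude_mul ht (u := fun n => α n * Real.cos (α n * 0)) fun n =>
      abs_mul_le_one_add_sq _ (Real.abs_cos_le_one _)) x
  have := ((((hasDerivAt_id y).const_mul (α n)).cos).const_mul (α n)).const_mul
    (amplitude c α Y n t)
  refine this.congr_deriv ?_
  simp only [id, mul_one]
  ring

theorem iteratedDeriv_modalSum (h : ModalData c θ₁ θ₂ α Y) (ht : 0 < t) (x : ℝ) :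
    iteratedDeriv 2 (fun x => modalSum c α Y x t) x
      = ∑' n, amplitude c α Y n t * (-α n ^ 2 * Real.sin (α n * x)) := by
  rw [show (2 : ℕ) = 1 + 1 from rfl, iteratedDeriv_succ, iteratedDeriv_one,
    funext fun x => (h.hasDerivAt_modalSum ht x).deriv, (h.hasDerivAt_modalSum_x ht x).deriv]

theorem continuousOn_modalSum_xx (h : ModalData c θ₁ θ₂ α Y) :
    ContinuousOn (fun p : ℝ × ℝ =>
      ∑' n, amplitude c α Y n p.2 * (-α n ^ 2 * Real.sin (α n * p.1))) (univ ×ˢ Ioi 0) :=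
  h.continuousOn_tsum_amplitude (u := fun n x => -α n ^ 2 * Real.sin (α n * x))
    (fun n => by fun_prop) fun n x => abs_sq_mul_le_one_add_sq _ (Real.abs_sin_le_one _)

theorem continuousOn_modalSum (h : ModalData c θ₁ θ₂ α Y) :
    ContinuousOn (fun p : ℝ × ℝ => modalSum c α Y p.1 p.2) (univ ×ˢ Ioi 0) :=
  h.continuousOn_tsum_amplitude (u := fun n x => Real.sin (α n * x))
    (fun n => by fun_prop) fun n x => abs_le_one_add_sq _ (Real.abs_sin_le_one _)

theorem contDiff_modalSum (h : ModalData c θ₁ θ₂ α Y) (ht : 0 < t) :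
    ContDiff ℝ 2 (fun x => modalSum c α Y x t) := by
  have hxx : Continuous fun x => ∑' n, amplitude c α Y n t * (-α n ^ 2 * Real.sin (α n * x)) := by
    rw [← continuousOn_univ]
    exact h.continuousOn_modalSum_xx.comp (f := fun x => (x, t)) (by fun_prop)
      fun x _ => ⟨mem_univ _, ht⟩
  rw [show (2 : WithTop ℕ∞) = 1 + 1 from one_add_one_eq_two.symm, contDiff_succ_iff_deriv]
  refine ⟨fun x => (h.hasDerivAt_modalSum ht x).differentiableAt, by simp, ?_⟩
  rw [funext fun x => (h.hasDerivAt_modalSum ht x).deriv, contDiff_one_iff_deriv]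
  refine ⟨fun x => (h.hasDerivAt_modalSum_x ht x).differentiableAt, ?_⟩
  rwa [funext fun x => (h.hasDerivAt_modalSum_x ht x).deriv]

theorem modalSum_pde (h : ModalData c θ₁ θ₂ α Y) (ht : 0 < t) (x : ℝ) :
    HasDerivAt (fun s => modalSum c α Y x s)
      (iteratedDeriv 2 (fun z => modalSum c α Y z t) x + c * modalSum c α Y x t) t := by
  have hd : HasDerivAt (fun s => modalSum c α Y x s)
      (∑' n, amplitude c α Y n t * ((c - α n ^ 2) * Real.sin (α n * x))) t := by
    -- The amplitudes decrease in time, so their values at `t / 2` dominate on a neighbourhood of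
    -- `t`.
    have hmem : t ∈ Ioi (t / 2) := half_lt_self ht
    refine hasDerivAt_tsum_of_isPreconnected (t := Ioi (t / 2)) (y₀ := t)
      (g := fun n s => amplitude c α Y n s * Real.sin (α n * x))
      (g' := fun n s => amplitude c α Y n s * ((c - α n ^ 2) * Real.sin (α n * x)))
      ((h.summable_modeBound (half_pos ht)).mul_left (|c| + 1)) isOpen_Ioi isPreconnected_Ioi
      (fun n s _ => ?_) (fun n s hs => ?_) hmem (h.hasSum_modalSum ht x).summable hmem
    · have := ((((hasDerivAt_id s).const_mul (c - α n ^ 2)).exp).const_mul (Y n)).mul_const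
        (Real.sin (α n * x))
      refine this.congr_deriv ?_
      simp [amplitude]
      ring
    · have hs' : t / 2 ≤ s := le_of_lt hs
      have h1 : |(c - α n ^ 2) * Real.sin (α n * x)| ≤ (|c| + 1) * (1 + α n ^ 2) := by
        rw [abs_mul]
        refine (mul_le_of_le_one_right (abs_nonneg _) (Real.abs_sin_le_one _)).trans ?_
        refine (abs_sub _ _).trans ?_
        rw [abs_of_nonneg (sq_nonneg (α n))]
        nlinarith [mul_nonneg (abs_nonneg c) (sq_nonneg (α n))]
      rw [Real.norm_eq_abs, abs_mul, modeBound, mul_left_comm]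
      exact mul_le_mul (h.abs_amplitude_le hs' n) h1 (abs_nonneg _) (abs_nonneg _)
  refine hd.congr_deriv ?_
  rw [h.iteratedDeriv_modalSum ht, modalSum, ← tsum_mul_left, ← Summable.tsum_add]
  · refine tsum_congr fun n => ?_
    ring
  · exact h.summable_amplitude_mul ht fun n => abs_sq_mul_le_one_add_sq _ (Real.abs_sin_le_one _)
  · exact (h.hasSum_modalSum ht x).summable.mul_left c

theorem continuous_modalSum (h : ModalData c θ₁ θ₂ α Y) (ht : 0 < t) :
    Continuous fun x => modalSum c α Y x t := (h.contDiff_modalSum ht).continuous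

theorem continuous_kernel (θ₁ θ₂ : ℝ) : Continuous (kernel θ₁ θ₂) := by
  unfold kernel
  fun_prop

theorem modalSum_right_boundary (h : ModalData c θ₁ θ₂ α Y) (ht : 0 < t) :
    modalSum c α Y 1 t = ∫ ξ in (0 : ℝ)..1, kernel θ₁ θ₂ ξ * modalSum c α Y ξ t := by
  have hk := continuous_kernel θ₁ θ₂
  obtain ⟨M, hM⟩ := (isCompact_uIcc (a := (0 : ℝ)) (b := 1)).exists_bound_of_continuousOn
    hk.continuousOn
  have hs : HasSum (fun n => ∫ ξ in (0 : ℝ)..1,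
      kernel θ₁ θ₂ ξ * (amplitude c α Y n t * Real.sin (α n * ξ)))
      (∫ ξ in (0 : ℝ)..1, kernel θ₁ θ₂ ξ * modalSum c α Y ξ t) := by
    refine intervalIntegral.hasSum_integral_of_dominated_convergence
      (fun n _ => M * modeBound c α Y t n) (fun n => ?_) (fun n => ?_) ?_ (by simp) ?_
    · exact Continuous.aestronglyMeasurable (by fun_prop)
    · refine Eventually.of_forall fun ξ hξ => ?_
      rw [norm_mul]
      exact mul_le_mul (hM ξ (uIoc_subset_uIcc hξ)) (h.norm_amplitude_mul_le le_rfl n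
        (abs_le_one_add_sq _ (Real.abs_sin_le_one _))) (norm_nonneg _)
        ((norm_nonneg _).trans (hM ξ (uIoc_subset_uIcc hξ)))
    · exact Eventually.of_forall fun ξ _ => (h.summable_modeBound ht).mul_left M
    · exact Eventually.of_forall fun ξ _ => (h.hasSum_modalSum ht ξ).mul_left _
  refine (h.hasSum_modalSum ht 1).unique (hs.congr_fun fun n => ?_)
  simp only [mul_left_comm (kernel θ₁ θ₂ _), intervalIntegral.integral_const_mul,
    integral_kernel_mul_sin (h.pos n) (h.root n), mul_one]

theorem hasSineExpansion_modalSum (h : ModalData c θ₁ θ₂ α Y) (ht : 0 < t) :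
    HasSineExpansion α (fun n => amplitude c α Y n t) (fun x => modalSum c α Y x t) := by
  have hu := tendstoUniformly_tsum (h.summable_modeBound ht)
    (f := fun n x => amplitude c α Y n t * Real.sin (α n * x)) fun n x =>
      h.norm_amplitude_mul_le le_rfl n (abs_le_one_add_sq _ (Real.abs_sin_le_one _))
  rw [Metric.tendstoUniformly_iff] at hu
  refine ENNReal.tendsto_nhds_zero.2 fun ε hε => ?_
  -- The minimum with `1` keeps the radius finite when `ε = ∞`.
  have hε' : 0 < (min ε 1).toReal :=
    ENNReal.toReal_pos (lt_min hε one_pos).ne' (min_lt_of_right_lt ENNReal.one_lt_top).ne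
  filter_upwards [hu _ hε'] with F hF
  have h1 : normL2 (fun x => modalSum c α Y x t
      - ∑ n ∈ F, amplitude c α Y n t * Real.sin (α n * x))
      ≤ unitMeasure univ ^ (ENNReal.toReal 2)⁻¹ * ENNReal.ofReal (min ε 1).toReal :=
    eLpNorm_le_of_ae_bound (Eventually.of_forall fun x => (hF x).le)
  refine h1.trans ?_
  rw [measure_univ, ENNReal.one_rpow, one_mul,
    ENNReal.ofReal_toReal (min_lt_of_right_lt ENNReal.one_lt_top).ne]
  exact min_le_left _ _

theorem memLp_modalSum (h : ModalData c θ₁ θ₂ α Y) (ht : 0 < t) :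
    MemLp (fun x => modalSum c α Y x t) 2 unitMeasure :=
  memLp_of_continuousOn (h.continuous_modalSum ht).continuousOn

theorem tendsto_modalSum (h : ModalData c θ₁ θ₂ α Y) {y₀ : ℝ → ℝ} (hy₀ : MemLp y₀ 2 unitMeasure)
    (hY : HasSineExpansion α Y y₀) :
    Tendsto (fun t => normL2 fun x => modalSum c α Y x t - y₀ x) (𝓝[>] 0) (𝓝 0) := by
  have hS : ∀ t, 0 < t → ∀ h' : MemLp (fun x => modalSum c α Y x t) 2 unitMeasure,
      HasSum (fun n => Real.exp ((c - α n ^ 2) * t) • (Y n • sineLp (α n))) (h'.toLp _) := by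
    intro t ht h'
    refine ((hasSineExpansion_iff h').1 (h.hasSineExpansion_modalSum ht)).congr_fun fun n => ?_
    rw [smul_smul, amplitude, mul_comm]
  have hlim := tendsto_of_hasSum_smul (l := 𝓝[>] (0 : ℝ)) ((hasSineExpansion_iff hy₀).1 hY)
    (w := fun t n => Real.exp ((c - α n ^ 2) * t))
    (S := fun t => ∑' n, Real.exp ((c - α n ^ 2) * t) • (Y n • sineLp (α n))) ?_ (fun n => ?_) ?_
  · rw [tendsto_iff_edist_tendsto_0] at hlim
    refine hlim.congr' ?_
    filter_upwards [self_mem_nhdsWithin] with t ht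
    rw [(hS t ht (h.memLp_modalSum ht)).tsum_eq, Lp.edist_toLp_toLp]
    rfl
  · filter_upwards [self_mem_nhdsWithin] with t ht n
    exact ⟨(Real.exp_pos _).le, Real.exp_le_one_iff.2
      (mul_nonpos_of_nonpos_of_nonneg (h.exponent_nonpos n) (le_of_lt ht))⟩
  · have : Continuous fun t : ℝ => Real.exp ((c - α n ^ 2) * t) := by fun_prop
    simpa using (this.tendsto 0).mono_left nhdsWithin_le_nhds
  · filter_upwards [self_mem_nhdsWithin] with t ht
    exact (hS t ht (h.memLp_modalSum ht)).summable.hasSum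

theorem isClosedLoopSolution_modalSum (h : ModalData c θ₁ θ₂ α Y) {y₀ : ℝ → ℝ}
    (hy₀ : MemLp y₀ 2 unitMeasure) (hY : HasSineExpansion α Y y₀) :
    IsClosedLoopSolution c (kernel θ₁ θ₂) y₀ (modalSum c α Y) where
  continuousOn := h.continuousOn_modalSum.mono (prod_mono_left (subset_univ _))
  contDiffOn _ ht := (h.contDiff_modalSum ht).contDiffOn
  continuousOn_xx := (h.continuousOn_modalSum_xx.mono (prod_mono_left (subset_univ _))).congr
    fun p hp => h.iteratedDeriv_modalSum hp.2 p.1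
  pde x _ _ ht := h.modalSum_pde ht x
  left_boundary t _ := by simp [modalSum]
  right_boundary _ ht := h.modalSum_right_boundary ht
  initial := h.tendsto_modalSum hy₀ hY

theorem exists_decay (h : ModalData c θ₁ θ₂ α Y) {y₀ : ℝ → ℝ} (hy₀ : MemLp y₀ 2 unitMeasure)
    (hY : HasSineExpansion α Y y₀) {ε : ℝ} (hε : ∀ n, c - α n ^ 2 ≤ -ε) :
    ∃ M : ℝ, ∀ t : ℝ, 0 < t →
      normL2 (fun x => modalSum c α Y x t) ≤ ENNReal.ofReal (M * Real.exp (-ε * t)) := by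
  -- `M` bounds all finite partial sums of the initial expansion. Once `e^{-εt}` is factored out,
  -- the multipliers `e^{(c-α²+ε)t}` lie in `[0,1]`.
  obtain ⟨M, hM⟩ := exists_bound_sum ((hasSineExpansion_iff hy₀).1 hY).summable
  refine ⟨M, fun t ht => ?_⟩
  have hL := h.memLp_modalSum ht
  rw [normL2, ← ENNReal.ofReal_toReal hL.eLpNorm_ne_top, ← Lp.norm_toLp _ hL]
  refine ENNReal.ofReal_le_ofReal ?_
  refine le_of_tendsto ((hasSineExpansion_iff hL).1 (h.hasSineExpansion_modalSum ht)).norm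
    (Eventually.of_forall fun F => ?_)
  have e : ∑ n ∈ F, amplitude c α Y n t • sineLp (α n) = Real.exp (-ε * t) •
      ∑ n ∈ F, Real.exp ((c - α n ^ 2 + ε) * t) • (Y n • sineLp (α n)) := by
    rw [Finset.smul_sum]
    refine Finset.sum_congr rfl fun n _ => ?_
    rw [smul_smul, smul_smul, ← Real.exp_add, amplitude, mul_comm]
    ring_nf
  rw [e, norm_smul, Real.norm_of_nonneg (Real.exp_pos _).le, mul_comm]
  refine mul_le_mul_of_nonneg_right (norm_sum_smul_le (fun n => ⟨(Real.exp_pos _).le,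
    Real.exp_le_one_iff.2 ?_⟩) F fun G _ => hM G) (Real.exp_pos _).le
  exact mul_nonpos_of_nonpos_of_nonneg (by linarith [hε n]) ht.le

end ModalData

end KernelOpt

end

/-! ### The stability theorem -/

theorem theorem1 (c T ε a₁ b₁ a₂ b₂ : ℝ) (hc : 0 < c) (hT : 0 < T) (hε : 0 < ε)
    (y₀ : ℝ → ℝ) (hy₀ : MemLp y₀ 2 KernelOpt.unitMeasure)
    (θ₁ θ₂ αstar : ℝ)
    (hopt : KernelOpt.IsOptimal c T ε a₁ b₁ a₂ b₂ y₀ θ₁ θ₂ αstar)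
    (hleast : IsLeast {β : ℝ | 0 < β ∧ KernelOpt.charLHS θ₁ θ₂ β = 0} αstar)
    (α : ℕ → ℝ) (hα : ∀ n, 0 < α n ∧ KernelOpt.charLHS θ₁ θ₂ (α n) = 0)
    (hspan : KernelOpt.InSineSpan α y₀) :
    KernelOpt.IsStable c (KernelOpt.kernel θ₁ θ₂) y₀ ε ∧
    (∀ n, c - α n ^ 2 ≤ -ε) ∧
    ∃ Y : ℕ → ℝ, KernelOpt.HasSineExpansion α Y y₀ ∧
      ∀ y : ℝ → ℝ → ℝ, KernelOpt.IsClosedLoopSolution c (KernelOpt.kernel θ₁ θ₂) y₀ y →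
        ∀ x ∈ Icc (0 : ℝ) 1, ∀ t : ℝ, 0 < t →
          HasSum (fun n => Y n * Real.exp ((c - α n ^ 2) * t) * Real.sin (α n * x)) (y x t) := by
  have hpos : 0 < αstar := hleast.1.1
  have hle : ∀ n, αstar ≤ α n := fun n => hleast.2 (hα n)
  have hexp : ∀ n, c - α n ^ 2 ≤ -ε := fun n =>
    (sub_le_sub_left (pow_le_pow_left₀ hpos.le (hle n) 2) c).trans hopt.feasible.exponent_le
  obtain ⟨Y₀, hY₀⟩ := hspan
  -- The sequence `α` may repeat a root, so the given coefficients are first collected by frequency.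
  obtain ⟨Y, hsum, hinj⟩ := KernelOpt.exists_hasSum_injOn_support
    (fun n => KernelOpt.sineLp_ne_zero (hα n).1) ((KernelOpt.hasSineExpansion_iff hy₀).1 hY₀)
  have hY : KernelOpt.HasSineExpansion α Y y₀ := (KernelOpt.hasSineExpansion_iff hy₀).2 hsum
  have hdata : KernelOpt.ModalData c θ₁ θ₂ α Y :=
    { pos := fun n => (hα n).1
      root := fun n => (hα n).2
      exponent_nonpos := fun n => (hexp n).trans (neg_nonpos.2 hε.le)
      bounded := KernelOpt.exists_bound_coeff hpos hle hsum.summable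
      injOn := hinj }
  have hk := KernelOpt.ModalData.continuous_kernel θ₁ θ₂
  have hsol := hdata.isClosedLoopSolution_modalSum hy₀ hY
  refine ⟨⟨⟨_, hsol⟩, fun y z hy hz x hx t ht => hy.unique hz hk hy₀ hx ht, fun y hy => ?_⟩,
    hexp, Y, hY, fun y hy x hx t ht => ?_⟩
  · obtain ⟨M, hM⟩ := hdata.exists_decay hy₀ hY hexp
    refine ⟨M, fun t ht => le_of_eq_of_le (eLpNorm_congr_ae ?_) (hM t ht)⟩
    exact (ae_restrict_iff' measurableSet_Icc).2
      (Eventually.of_forall fun x hx => hy.unique hsol hk hy₀ hx ht)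
  · rw [hy.unique hsol hk hy₀ hx ht]
    exact hdata.hasSum_modalSum ht x
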